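/- **Conventions.** For a cardinal $\theta$, $H(\theta)$ is the class of all sets whose transitive closure has size less than $\theta$, and $\prec$ denotes elementary submodel for the language of set theory $\{\in\}$. $\mathsf{ZFC}^-$ is $\mathsf{ZFC}$ without the power set axiom, with the collection scheme, and with choice in the form that every set can be well-ordered. Let $\kappa$ be an infinite cardinal. A *weak $\kappa$-model* is a (not necessarily transitive) set $M$ of size $\kappa$ such that $\kappa+1\subseteq M$ and $\langle M,\in\rangle\models\mathsf{ZFC}^-$. For a cardinal $\alpha$, $M$ is *closed under ${<}\alpha$-sequences* if every function from an ordinal $\gamma<\alpha$ to $M$ is an element of $M$. An elementary embedding $j\colon\langle M,\in\rangle\to\langle N,\in\rangle$, with $N$ a set, is *$\kappa$-powerset preserving* if it has critical point $\kappa$ (that is, $j(\xi)=\xi$ for all $\xi<\kappa$ and $j(\kappa)\neq\kappa$) and $M$ and $N$ have the same subsets of $\kappa$, that is, $\{x\in M\mid x\cap M\subseteq\kappa\}=\{x\in N\mid x\cap N\subseteq\kappa\}$. Let $\alpha\le\kappa$ be regular cardinals. $\kappa$ is *$\alpha$-Ramsey* if for arbitrarily large regular cardinals $\theta$, every $A\subseteq\kappa$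 is an element of some weak $\kappa$-model $M\prec H(\theta)$ that is closed under ${<}\alpha$-sequences and for which there is a $\kappa$-powerset preserving elementary embedding $j\colon M\to N$. A cardinal $\kappa$ is *Ramsey* if it is uncountable and $\kappa\to(\kappa)^{<\omega}_2$, that is, for every $f\colon[\kappa]^{<\omega}\to 2$ there is $X\subseteq\kappa$ of size $\kappa$ such that $f$ is constant on $[X]^n$ for every $n<\omega$. **Proposition.** If $\kappa$ is $\omega_1$-Ramsey, then $\kappa$ is a Ramsey cardinal and a limit of Ramsey cardinals; that is, $\kappa$ is Ramsey, and for every cardinal $\mu<\kappa$ there is a Ramsey cardinal $\nu$ with $\mu<\nu<\kappa$. -/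

import Mathlib

universe u

namespace LargeCardinal

open Cardinal FirstOrder

/-! ### First-order logic over sets of sets -/

/-- The only symbol of the language of set theory: a binary relation symbol. -/
inductive MemRel : ℕ → Type
  | mem : MemRel 2

/-- The first-order language of set theory. -/
def setLang : FirstOrder.Language.{0, 0} := ⟨fun _ => Empty, MemRel⟩

/-- A collection of sets, viewed as a first-order structure: the symbol is interpreted by the true
membership relation. This applies to `ZFSet`s and to classes `Set ZFSet` alike. -/
instance memStructure (p : ZFSet.{u} → Prop) : setLang.Structure (Subtype p) where
  funMap := fun f => Empty.elim f
  RelMap := fun r => match r with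
    | MemRel.mem => fun v => (v 0 : ZFSet.{u}) ∈ (v 1 : ZFSet.{u})

theorem relMap_mem {p : ZFSet.{u} → Prop} (v : Fin 2 → Subtype p) :
    FirstOrder.Language.Structure.RelMap (L := setLang) (M := Subtype p) (n := 2) MemRel.mem v ↔
      (v 0 : ZFSet.{u}) ∈ (v 1 : ZFSet.{u}) :=
  Iff.rfl

/-! ### Models of `ZFC` without the power set axiom -/

section ZFCMinus

variable {M : ZFSet.{u}}

/-- Inside `⟨M, ∈⟩`, `p` is the unordered pair `{a, b}`. -/
def IsUPairIn (p a b : M) : Prop :=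
  ∀ z : M, z.1 ∈ p.1 ↔ z = a ∨ z = b

/-- Inside `⟨M, ∈⟩`, `p` is the Kuratowski ordered pair `{{a}, {a, b}}`. -/
def IsOPairIn (p a b : M) : Prop :=
  ∃ s t : M, IsUPairIn s a a ∧ IsUPairIn t a b ∧ IsUPairIn p s t

/-- Inside `⟨M, ∈⟩`, the ordered pair of `a` and `b` belongs to `r`. -/
def RelatesIn (r a b : M) : Prop :=
  ∃ p : M, p.1 ∈ r.1 ∧ IsOPairIn p a b

/-- Inside `⟨M, ∈⟩`, the relation `r` is a strict well-order of the set `x`. -/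
structure WellOrdersIn (r x : M) : Prop where
  irrefl : ∀ a : M, a.1 ∈ x.1 → ¬ RelatesIn r a a
  trans : ∀ a b c : M, a.1 ∈ x.1 → b.1 ∈ x.1 → c.1 ∈ x.1 →
    RelatesIn r a b → RelatesIn r b c → RelatesIn r a c
  total : ∀ a b : M, a.1 ∈ x.1 → b.1 ∈ x.1 → RelatesIn r a b ∨ a = b ∨ RelatesIn r b a
  least : ∀ y : M, (∀ a : M, a.1 ∈ y.1 → a.1 ∈ x.1) → (∃ a : M, a.1 ∈ y.1) →
    ∃ m : M, m.1 ∈ y.1 ∧ ∀ b : M, b.1 ∈ y.1 → ¬ RelatesIn r b m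

end ZFCMinus

/-- `⟨M, ∈⟩ ⊨ ZFC⁻`, that is `ZFC` without power set, with the collection scheme; as usual in the
absence of power sets, choice is the statement that every set can be well-ordered. Single axioms
are written with quantifiers over `M`; the two schemes range over all first-order formulas with
parameters from `M`. -/
structure ModelsZFCMinus (M : ZFSet.{u}) : Prop where
  extensionality : ∀ x y : M, (∀ z : M, z.1 ∈ x.1 ↔ z.1 ∈ y.1) → x = y
  foundation : ∀ x : M, (∃ y : M, y.1 ∈ x.1) →
    ∃ y : M, y.1 ∈ x.1 ∧ ∀ z : M, ¬ (z.1 ∈ x.1 ∧ z.1 ∈ y.1)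
  pairing : ∀ a b : M, ∃ p : M, IsUPairIn p a b
  union : ∀ x : M, ∃ y : M, ∀ z : M, z.1 ∈ y.1 ↔ ∃ w : M, w.1 ∈ x.1 ∧ z.1 ∈ w.1
  infinity : ∃ w : M, (∃ e : M, e.1 ∈ w.1 ∧ ∀ z : M, z.1 ∉ e.1) ∧
    ∀ x : M, x.1 ∈ w.1 → ∃ y : M, y.1 ∈ w.1 ∧ ∀ z : M, z.1 ∈ y.1 ↔ z.1 ∈ x.1 ∨ z = x
  separation : ∀ (n : ℕ) (φ : setLang.Formula (Fin (n + 1))) (v : Fin n → M) (a : M),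
    ∃ b : M, ∀ x : M, x.1 ∈ b.1 ↔ x.1 ∈ a.1 ∧ φ.Realize (Fin.cons x v : Fin (n + 1) → M)
  collection : ∀ (n : ℕ) (φ : setLang.Formula (Fin (n + 2))) (v : Fin n → M) (a : M),
    (∀ x : M, x.1 ∈ a.1 →
      ∃ y : M, φ.Realize (Fin.cons x (Fin.cons y v : Fin (n + 1) → M) : Fin (n + 2) → M)) →
    ∃ b : M, ∀ x : M, x.1 ∈ a.1 →
      ∃ y : M, y.1 ∈ b.1 ∧
        φ.Realize (Fin.cons x (Fin.cons y v : Fin (n + 1) → M) : Fin (n + 2) → M)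
  choice : ∀ x : M, ∃ r : M, WellOrdersIn r x

/-! ### Weak `κ`-models and embeddings -/

/-- The cardinal `κ` as a set, namely as an initial von Neumann ordinal. -/
noncomputable def cardSet (κ : Cardinal.{u}) : ZFSet.{u} := κ.ord.toZFSet

/-- `H(θ)`, the class of all sets whose transitive closure has size less than `θ`. The transitive
closure of `x` is the least transitive set containing `x` as a subset, so it has size less than `θ`
iff some transitive superset of `x` has. -/
def H (θ : Cardinal.{u}) : Set ZFSet.{u} :=
  {x | ∃ t : ZFSet.{u}, t.IsTransitive ∧ x ⊆ t ∧ t.card < θ}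

/-- A weak `κ`-model: a (not necessarily transitive) set `M` of size `κ` with `κ + 1 ⊆ M` and
`⟨M, ∈⟩ ⊨ ZFC⁻`. -/
structure IsWeakModel (κ : Cardinal.{u}) (M : ZFSet.{u}) : Prop where
  card_eq : M.card = κ
  succ_subset : insert (cardSet κ) (cardSet κ) ⊆ M
  models : ModelsZFCMinus M

theorem IsWeakModel.cardSet_mem {κ : Cardinal.{u}} {M : ZFSet.{u}} (h : IsWeakModel κ M) :
    cardSet κ ∈ M :=
  h.succ_subset (ZFSet.mem_insert _ _)

/-- `M ≺ X`: `M` is a subset of `X` and the inclusion map is elementary. -/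
def IsElementarySubmodel (M : ZFSet.{u}) (X : Set ZFSet.{u}) : Prop :=
  ∃ i : M ↪ₑ[setLang] X, ∀ x : M, (i x : ZFSet.{u}) = x

/-- `M` is closed under `<α`-sequences: every function from an ordinal below `α` to `M`
is an element of `M`. -/
def ClosedUnderSeq (α : Cardinal.{u}) (M : ZFSet.{u}) : Prop :=
  ∀ γ < α.ord, ∀ f : ZFSet.{u}, ZFSet.IsFunc γ.toZFSet M f → f ∈ M

/-- The subsets of `κ` in the sense of `⟨M, ∈⟩`. For `M` transitive, or elementary in some `H(θ)`
and containing `κ`, these are just the elements of `M` that are subsets of `κ`. -/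
def subsetsIn (M : ZFSet.{u}) (κ : Cardinal.{u}) : Set ZFSet.{u} :=
  {x | x ∈ M ∧ ∀ y ∈ M, y ∈ x → y ∈ cardSet κ}

/-- The elementary embedding `j : M → N` of `∈`-structures is `κ`-powerset preserving: it has
critical point `κ` (all ordinals below `κ` are fixed and `κ` is moved), and `M` and `N` have the
same subsets of `κ`. -/
structure IsPowersetPreserving (κ : Cardinal.{u}) {M N : ZFSet.{u}}
    (j : M ↪ₑ[setLang] N) : Prop where
  fixes : ∀ x : M, x.1 ∈ cardSet κ → (j x : ZFSet.{u}) = x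
  moves : ∀ x : M, x.1 = cardSet κ → (j x : ZFSet.{u}) ≠ x
  same_subsets : subsetsIn M κ = subsetsIn N κ

/-! ### The large cardinal notions -/

/-- `κ` is `α`-Ramsey, where `α ≤ κ` are regular cardinals: for arbitrarily large regular `θ`, every
`A ⊆ κ` is an element of some weak `κ`-model `M ≺ H(θ)` that is closed under `<α`-sequences and
for which there is a `κ`-powerset preserving elementary embedding `j : M → N`. -/
structure IsAlphaRamsey (α κ : Cardinal.{u}) : Prop where
  regular_left : α.IsRegular
  regular : κ.IsRegular
  le : α ≤ κ
  exists_embedding : ∀ μ : Cardinal.{u}, ∃ θ : Cardinal.{u}, μ < θ ∧ θ.IsRegular ∧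
    ∀ A : ZFSet.{u}, A ⊆ cardSet κ →
      ∃ M : ZFSet.{u}, A ∈ M ∧ IsWeakModel κ M ∧ IsElementarySubmodel M (H θ) ∧
        ClosedUnderSeq α M ∧
        ∃ (N : ZFSet.{u}) (j : M ↪ₑ[setLang] N), IsPowersetPreserving κ j

/-- `κ` is a Ramsey cardinal: it is uncountable and `κ → (κ)^{<ω}_2`, i.e. for every colouring of
the finite subsets of `κ` in two colours there is a set `X ⊆ κ` of size `κ` such that, for each
`n`, all `n`-element subsets of `X` have the same colour. -/
def IsRamsey (κ : Cardinal.{u}) : Prop :=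
  ℵ₀ < κ ∧ ∀ f : Finset κ.ord.ToType → Bool, ∃ X : Set κ.ord.ToType, #X = κ ∧
    ∀ s t : Finset κ.ord.ToType, (s : Set κ.ord.ToType) ⊆ X → (t : Set κ.ord.ToType) ⊆ X →
      s.card = t.card → f s = f t

end LargeCardinal

namespace LargeCardinal

open Cardinal Ordinal Set

/-! ### A pairing function on the ordinals -/

/-! All data are coded as sets of ordinals, because subsets of κ are what M and N share. A set S
codes colourings S_k = {ξ | code(k, ξ) ∈ S}. A point a is end-homogeneous if the S_k-colour of a
pair (ξ, a) is the S_{k+1}-colour of ξ, whatever a is. Removing the largest elements of a finite set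
of such points one by one turns its S_0-colour into S_n(ω), which depends only on its size n. So it
suffices that every F is S_0 for some S with unboundedly many end-homogeneous points
(`EndHomogeneous.isRamsey`).

Given j : M → N and F ∈ M, the derivative {ξ < κ | code(ξ, κ) ∈ j(F)} lies in N, hence in M.
Countable closure puts the sequence of iterated derivatives, and so its join S, into M. By
construction κ is end-homogeneous for j(S) in N, so κ ∈ j(X) for the set X of end-homogeneous points
of S, and X is unbounded by elementarity (`PreservingSetting.exists_homogeneous`).

The witnesses S and X are subsets of κ, so they also lie in N. Thus N sees κ < j(κ) as
end-homogeneous, and this reflects below κ (`PreservingSetting.exists_endHomogeneous_lt`). The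
reflected ordinal is a cardinal by `EndHomogeneous.ord_cof`.

Neither M nor N need be transitive, so notions are relativised to the structures and compared on the
ordinals up to κ, which belong to both. -/

/-- The first ordinal that codes a pair with second coordinate `a`. -/
noncomputable def pairBase (a : Ordinal.{u}) : Ordinal.{u} :=
  ⨆ b : Iio a, (pairBase b.1 + b.1 + 1)
termination_by a
decreasing_by exact b.2

/-- A code for the pair `(ξ, a)`, where `ξ ≤ a`: its position in the reverse lexicographic order. -/
noncomputable def pairCode (ξ a : Ordinal.{u}) : Ordinal.{u} := pairBase a + ξ

theorem lt_pairBase_iff {z a : Ordinal.{u}} : z < pairBase a ↔ ∃ b < a, z ≤ pairCode b b := by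
  rw [pairBase, Ordinal.lt_iSup_iff]
  simp [pairCode]

theorem pairCode_self_lt {a b : Ordinal.{u}} (h : b < a) : pairCode b b < pairBase a :=
  lt_pairBase_iff.2 ⟨b, h, le_rfl⟩

theorem pairCode_lt_pairBase {ξ a b : Ordinal.{u}} (hξ : ξ ≤ b) (h : b < a) :
    pairCode ξ b < pairBase a :=
  (add_le_add_right hξ _).trans_lt (pairCode_self_lt h)

theorem le_pairBase (a : Ordinal.{u}) : a ≤ pairBase a := by
  refine le_of_forall_lt fun b hb => ?_
  exact lt_pairBase_iff.2 ⟨b, hb, le_add_self⟩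

theorem le_pairCode (ξ a : Ordinal.{u}) : a ≤ pairCode ξ a :=
  (le_pairBase a).trans le_self_add

theorem pairCode_lt_pairCode {ξ a η b : Ordinal.{u}} (hη : η ≤ b)
    (h : b < a ∨ b = a ∧ η < ξ) : pairCode η b < pairCode ξ a := by
  rcases h with h | ⟨rfl, h⟩
  · exact (pairCode_lt_pairBase hη h).trans_le le_self_add
  · exact add_lt_add_right h _

theorem pairCode_inj {ξ a η b : Ordinal.{u}} (hξ : ξ ≤ a) (hη : η ≤ b)
    (h : pairCode ξ a = pairCode η b) : ξ = η ∧ a = b := by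
  rcases lt_trichotomy a b with hab | rfl | hab
  · exact absurd h (pairCode_lt_pairCode hξ (.inl hab)).ne
  · exact ⟨add_left_cancel h, rfl⟩
  · exact absurd h (pairCode_lt_pairCode hη (.inl hab)).ne'

theorem lt_pairBase_exists {a z : Ordinal.{u}} (hz : z < pairBase a) :
    ∃ b < a, ∃ η ≤ b, z = pairCode η b := by
  induction a using WellFoundedLT.induction with
  | ind a ih =>
    obtain ⟨b, hb, hzb⟩ := lt_pairBase_iff.1 hz
    rcases lt_or_ge z (pairBase b) with h | h
    · obtain ⟨c, hc, η, hη, rfl⟩ := ih b hb h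
      exact ⟨c, hc.trans hb, η, hη, rfl⟩
    · obtain ⟨η, rfl⟩ := exists_add_of_le h
      exact ⟨b, hb, η, le_of_add_le_add_left hzb, rfl⟩

/-- There are no gaps below a code, so as a von Neumann ordinal it is the set of codes of smaller
pairs. This ∈-recursion is what can be stated inside the models. -/
theorem lt_pairCode_iff {ξ a z : Ordinal.{u}} (hξ : ξ ≤ a) : z < pairCode ξ a ↔
    ∃ b η, η ≤ b ∧ (b < a ∨ b = a ∧ η < ξ) ∧ z = pairCode η b := by
  constructor
  · intro hz
    rcases lt_or_ge z (pairBase a) with h | h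
    · obtain ⟨b, hb, η, hη, rfl⟩ := lt_pairBase_exists h
      exact ⟨b, η, hη, .inl hb, rfl⟩
    · obtain ⟨η, rfl⟩ := exists_add_of_le h
      have := lt_of_add_lt_add_left hz
      exact ⟨a, η, this.le.trans hξ, .inr ⟨rfl, this⟩, rfl⟩
  · rintro ⟨b, η, hη, h, rfl⟩
    exact pairCode_lt_pairCode hη h

theorem pairBase_lt_ord {κ : Cardinal.{u}} (hκ : κ.IsRegular) {a : Ordinal.{u}}
    (ha : a < κ.ord) : pairBase a < κ.ord := by
  induction a using WellFoundedLT.induction with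
  | ind a ih =>
    rw [pairBase]
    refine lift_iSup_add_one_lt_of_lt_cof ?_ fun i => ?_
    · rw [← lift_cof, hκ.cof_ord, Cardinal.mk_Iio_ordinal]
      simpa [← lift_card] using lt_ord.1 ha
    · exact isPrincipal_add_ord hκ.aleph0_le (ih _ i.2 (i.2.trans ha)) (i.2.trans ha)

theorem pairCode_lt_ord {κ : Cardinal.{u}} (hκ : κ.IsRegular) {ξ a : Ordinal.{u}}
    (hξ : ξ ≤ a) (ha : a < κ.ord) : pairCode ξ a < κ.ord :=
  isPrincipal_add_ord hκ.aleph0_le (pairBase_lt_ord hκ ha) (hξ.trans_lt ha)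

/-! ### A partition property of ordinals -/

/-- The ordinal `a` is an end-homogeneous point for the countably many colourings
`{ξ | pairCode k ξ ∈ S}`, `k < ω`. -/
structure EndHomogeneousAt (S : Set Ordinal.{u}) (a : Ordinal.{u}) : Prop where
  omega_lt : ω < a
  closed : ∀ b < a, ∀ ξ ≤ b, pairCode ξ b < a
  -- The bound on ξ keeps every pair in the range, first coordinate at most second, where codes are
  -- injective.
  iff : ∀ k : ℕ, ∀ ξ < a, (k + 1 : Ordinal) < ξ →
    (pairCode k (pairCode ξ a) ∈ S ↔ pairCode (k + 1) ξ ∈ S)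

/-- Every colouring `F` of `ν` is the first one in a sequence of colourings for which unboundedly
many points of `ν` are simultaneously end-homogeneous. -/
def EndHomogeneous (ν : Ordinal.{u}) : Prop :=
  ∀ F : Set Ordinal.{u}, F ⊆ Iio ν → ∃ S X : Set Ordinal.{u}, X ⊆ Iio ν ∧
    (∀ β < ν, ∃ a ∈ X, β < a) ∧ (∀ a ∈ X, EndHomogeneousAt S a) ∧
    ∀ ξ < ν, 0 < ξ → (pairCode 0 ξ ∈ S ↔ ξ ∈ F)

theorem EndHomogeneous.exists_gt {ν β : Ordinal.{u}} (h : EndHomogeneous ν) (hβ : β < ν) :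
    ∃ a < ν, β < a ∧ ω < a ∧ ∀ b < a, ∀ ξ ≤ b, pairCode ξ b < a := by
  obtain ⟨S, X, hX, hub, hS, -⟩ := h ∅ (by simp)
  obtain ⟨a, ha, hβa⟩ := hub β hβ
  exact ⟨a, hX ha, hβa, (hS a ha).omega_lt, (hS a ha).closed⟩

theorem EndHomogeneous.pairCode_lt {ν ξ b : Ordinal.{u}} (h : EndHomogeneous ν) (hξ : ξ ≤ b)
    (hb : b < ν) : pairCode ξ b < ν := by
  obtain ⟨a, ha, hba, -, hcl⟩ := h.exists_gt hb
  exact (hcl b hba ξ hξ).trans ha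

/-- Colour (i, a) by whether i < r a. On end-homogeneous points above c + 2 the colour does not
depend on a, so r is constant there. -/
theorem EndHomogeneous.exists_unbounded_fiber {ν c : Ordinal.{u}} (h : EndHomogeneous ν)
    (hc : c < ν) (r : Ordinal.{u} → Ordinal.{u}) (hr : ∀ a < ν, r a < c) :
    ∃ i, ∀ β < ν, ∃ a < ν, β < a ∧ r a = i := by
  -- The shift by 2 makes the first coordinate exceed 1, as `EndHomogeneousAt.iff` requires for k =
  -- 0.
  let F : Set Ordinal.{u} := {z | z < ν ∧ ∃ a < ν, ∃ i < r a, i + 2 < a ∧ z = pairCode (i + 2) a}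
  obtain ⟨S, X, hX, hub, hS, hF⟩ := h F fun z hz => hz.1
  have hlim : ∀ β < ν, β + 1 < ν := fun β hβ => by
    obtain ⟨a, ha, hβa, -⟩ := h.exists_gt hβ
    exact (Order.add_one_le_of_lt hβa).trans_lt ha
  have hc2 : c + 2 < ν := by
    have := hlim _ (hlim c hc)
    rwa [add_assoc, one_add_one_eq_two] at this
  have key : ∀ a ∈ X, c + 2 < a → ∀ i < c, (i < r a ↔ pairCode 1 (i + 2) ∈ S) := by
    intro a ha hca i hi
    have hia : i + 2 < a := lt_of_le_of_lt (by gcongr) hca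
    have h1 := (hS a ha).iff 0 (i + 2) hia (by
      rw [Nat.cast_zero, zero_add]
      exact one_lt_two.trans_le le_add_self)
    rw [Nat.cast_zero, zero_add] at h1
    have hlt : pairCode (i + 2) a < ν := h.pairCode_lt hia.le (hX ha)
    rw [← h1, hF _ hlt (hia.bot_lt.trans_le (le_pairCode _ _))]
    constructor
    · exact fun hir => ⟨hlt, a, hX ha, i, hir, hia, rfl⟩
    · rintro ⟨-, b, hb, i', hi', hib, heq⟩
      obtain ⟨h2, rfl⟩ := pairCode_inj hia.le hib.le heq
      have h3 : i = i' := by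
        rw [← one_add_one_eq_two, ← add_assoc, ← add_assoc] at h2
        exact Order.succ_injective (Order.succ_injective h2)
      exact h3 ▸ hi'
  obtain ⟨a₀, ha₀, hca₀⟩ := hub _ hc2
  refine ⟨r a₀, fun β hβ => ?_⟩
  obtain ⟨a, ha, hβa⟩ := hub (max β (c + 2)) (max_lt hβ hc2)
  rw [max_lt_iff] at hβa
  refine ⟨a, hX ha, hβa.1, le_antisymm (le_of_forall_lt fun i hi => ?_)
    (le_of_forall_lt fun i hi => ?_)⟩
  · have := hi.trans (hr a (hX ha))
    exact (key a₀ ha₀ hca₀ i this).2 ((key a ha hβa.2 i this).1 hi)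
  · have := hi.trans (hr a₀ (hX ha₀))
    exact (key a ha hβa.2 i this).2 ((key a₀ ha₀ hca₀ i this).1 hi)

/-- Map each a to the index of a bound for it in a short cofinal set. This map would be constant on
an unbounded set, so one element of the cofinal set would bound all of it. -/
theorem EndHomogeneous.ord_cof {ν : Ordinal.{u}} (h : EndHomogeneous ν) : ν.cof.ord = ν := by
  refine (ord_cof_le ν).antisymm (not_lt.1 fun hlt => ?_)
  obtain ⟨s, hs, hcard⟩ := Order.exists_cof_eq ν.ToType
  rw [cof_toType] at hcard
  obtain ⟨w, hw, hws⟩ := Cardinal.exists_ord_eq s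
  have hex : ∀ a : Iio ν, ∃ i : s, ToType.mk a ≤ i.1 := fun a => by
    obtain ⟨i, hi, hai⟩ := hs (ToType.mk a)
    exact ⟨⟨i, hi⟩, hai⟩
  choose g hg using hex
  classical
  obtain ⟨i, hi⟩ := h.exists_unbounded_fiber hlt
    (fun a => if ha : a < ν then typein w (g ⟨a, ha⟩) else 0) fun a ha => by
      simp only [ha, dif_pos]
      rw [← hcard, hws]
      exact typein_lt_type _ _
  obtain ⟨a, ha, -, hai⟩ := hi 0 (pos_of_gt hlt)
  obtain ⟨b, hb, hab, hbi⟩ := hi (ToType.mk.symm (g ⟨a, ha⟩).1).1 (ToType.mk.symm (g ⟨a, ha⟩).1).2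
  simp only [ha, hb, dif_pos] at hai hbi
  have hgg : g ⟨a, ha⟩ = g ⟨b, hb⟩ := typein_injective w (hai.trans hbi.symm)
  have hle := hg ⟨b, hb⟩
  rw [← hgg, ← OrderIso.le_symm_apply] at hle
  exact hab.not_ge hle

/-! ### The partition property implies Ramseyness -/

/-- A code for a descending list of ordinals. -/
noncomputable def listCode : List Ordinal.{u} → Ordinal.{u}
  | [] => ω
  | a :: l => pairCode (listCode l) a

/-- Each entry of the list exceeds `ω` and bounds the code of its tail. -/
def Codable : List Ordinal.{u} → Prop
  | [] => True
  | a :: l => ω < a ∧ listCode l ≤ a ∧ Codable l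

theorem listCode_injective {l l' : List Ordinal.{u}} (h : Codable l) (h' : Codable l')
    (heq : listCode l = listCode l') : l = l' := by
  induction l generalizing l' with
  | nil =>
    cases l' with
    | nil => rfl
    | cons b l' => exact absurd heq (h'.1.trans_le (le_pairCode _ _)).ne
  | cons a l ih =>
    cases l' with
    | nil => exact absurd heq (h.1.trans_le (le_pairCode _ _)).ne'
    | cons b l' =>
      obtain ⟨h1, rfl⟩ := pairCode_inj h.2.1 h'.2.1 heq
      rw [ih h.2.2 h'.2.2 h1]

/-- The reason for coding the empty list by ω: every code then exceeds each k + 1, within the scope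
of `EndHomogeneousAt.iff`. -/
theorem omega_le_listCode {l : List Ordinal.{u}} (h : Codable l) : ω ≤ listCode l := by
  cases l with
  | nil => exact le_rfl
  | cons a l => exact h.1.le.trans (le_pairCode _ _)

theorem listCode_lt {S : Set Ordinal.{u}} {a : Ordinal.{u}} (ha : EndHomogeneousAt S a)
    {l : List Ordinal.{u}} (hc : Codable l) (hl : ∀ b ∈ l, b < a) : listCode l < a := by
  cases l with
  | nil => exact ha.omega_lt
  | cons b l => exact ha.closed b (hl b (by simp)) _ hc.2.1

theorem codable_of_pairwise {S : Set Ordinal.{u}} {l : List Ordinal.{u}}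
    (h : ∀ a ∈ l, EndHomogeneousAt S a) (hl : l.Pairwise (· > ·)) : Codable l := by
  induction l with
  | nil => trivial
  | cons a l ih =>
    rw [List.pairwise_cons] at hl
    have hc := ih (fun b hb => h b (by simp [hb])) hl.2
    exact ⟨(h a (by simp)).omega_lt, (listCode_lt (h a (by simp)) hc hl.1).le, hc⟩

/-- Each use of `EndHomogeneousAt.iff` drops the largest entry and raises the index of the colouring
by one. -/
theorem pairCode_listCode_mem {S : Set Ordinal.{u}} {l : List Ordinal.{u}}
    (h : ∀ a ∈ l, EndHomogeneousAt S a) (hl : l.Pairwise (· > ·)) (k : ℕ) :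
    pairCode k (listCode l) ∈ S ↔ pairCode (k + l.length : ℕ) ω ∈ S := by
  induction l generalizing k with
  | nil => rfl
  | cons a l ih =>
    have hl' := List.pairwise_cons.1 hl
    have h' : ∀ b ∈ l, EndHomogeneousAt S b := fun b hb => h b (by simp [hb])
    have hc := codable_of_pairwise h' hl'.2
    have ha := h a (by simp)
    have hk : ((k + 1 : ℕ) : Ordinal.{u}) < listCode l :=
      (natCast_lt_omega0 _).trans_le (omega_le_listCode hc)
    rw [Nat.cast_add, Nat.cast_one] at hk
    rw [listCode, ha.iff k _ (listCode_lt ha hc hl'.1) hk]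
    have := ih h' hl'.2 (k + 1)
    rw [Nat.cast_add, Nat.cast_one] at this
    rw [this, List.length_cons, Nat.add_assoc, Nat.add_comm 1]

/-- The colouring of finite sets becomes the set F of codes of their descending enumerations. -/
theorem EndHomogeneous.isRamsey {c : Cardinal.{u}} (h : EndHomogeneous c.ord) (hc : 0 < c) :
    IsRamsey c := by
  have h0 : (0 : Ordinal.{u}) < c.ord := by simpa using hc
  refine ⟨?_, fun f => ?_⟩
  · obtain ⟨a, ha, -, hω, -⟩ := h.exists_gt h0
    exact omega0_lt_ord.1 (hω.trans ha)
  let e : c.ord.ToType → Ordinal.{u} := fun x => (ToType.mk.symm x).1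
  have he : StrictMono e := fun x y hxy => ToType.mk.symm.strictMono hxy
  have heinj := he.injective
  have helt : ∀ x, e x < c.ord := fun x => (ToType.mk.symm x).2
  let lst : Finset c.ord.ToType → List Ordinal.{u} := fun s => (s.sort (· ≥ ·)).map e
  have hlst : ∀ s, (lst s).Pairwise (· > ·) := fun s => by
    rw [List.pairwise_map]
    refine (s.sortedGT_sort.pairwise).imp fun hab => he hab
  have hinj : ∀ s t, lst s = lst t → s = t := fun s t hst => by
    have := List.map_injective_iff.2 heinj hst
    rw [← s.sort_toFinset (· ≥ ·), this, t.sort_toFinset]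
  let F : Set Ordinal.{u} :=
    {z | z < c.ord ∧ ∃ s, Codable (lst s) ∧ listCode (lst s) = z ∧ f s = true}
  obtain ⟨S, X, hX, hub, hS, hF⟩ := h F fun z hz => hz.1
  refine ⟨{x | e x ∈ X}, ?_, ?_⟩
  -- An unbounded set has full size, since `c.ord` is its own cofinality.
  · refine le_antisymm ((mk_set_le _).trans_eq (mk_ord_toType c)) ?_
    have hcof : IsCofinal {x : c.ord.ToType | e x ∈ X} := fun y => by
      obtain ⟨a, ha, hya⟩ := hub (e y) (helt y)
      refine ⟨ToType.mk ⟨a, hX ha⟩, ?_, ?_⟩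
      · simpa [e] using ha
      · refine he.le_iff_le.1 ?_
        simpa [e] using hya.le
    have := Order.cof_le hcof
    rwa [Ordinal.cof_toType, ord_inj.1 h.ord_cof] at this
  · have key : ∀ s : Finset c.ord.ToType, (s : Set c.ord.ToType) ⊆ {x | e x ∈ X} →
        (f s = true ↔ pairCode (s.card : ℕ) ω ∈ S) := by
      intro s hs
      have hhom : ∀ a ∈ lst s, EndHomogeneousAt S a := fun a ha => by
        obtain ⟨x, hx, rfl⟩ := List.mem_map.1 ha
        exact hS _ (hs (by simpa using hx))
      have hcod := codable_of_pairwise hhom (hlst s)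
      have h1 := pairCode_listCode_mem hhom (hlst s) 0
      have hlen : (lst s).length = s.card := by simp [lst]
      rw [hlen, Nat.zero_add, Nat.cast_zero] at h1
      have hlt : listCode (lst s) < c.ord := by
        have : ∃ b < c.ord, ∀ a ∈ lst s, a ≤ b := by
          cases hl : lst s with
          | nil => exact ⟨0, h0, by simp⟩
          | cons b l =>
            have hp := hlst s
            rw [hl, List.pairwise_cons] at hp
            refine ⟨b, ?_, ?_⟩
            · have : b ∈ lst s := by simp [hl]
              obtain ⟨x, -, rfl⟩ := List.mem_map.1 this
              exact helt x
            · simpa using fun a ha => (hp.1 a ha).le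
        obtain ⟨b, hb, hle⟩ := this
        obtain ⟨a, ha, hba⟩ := hub b hb
        exact (listCode_lt (hS a ha) hcod fun d hd => (hle d hd).trans_lt hba).trans (hX ha)
      rw [← h1, hF _ hlt (omega0_pos.trans_le (omega_le_listCode hcod))]
      constructor
      · exact fun hfs => ⟨hlt, s, hcod, rfl, hfs⟩
      · rintro ⟨-, t, ht, heq, hft⟩
        rwa [← hinj t s (listCode_injective ht hcod heq)]
    intro s t hs ht hst
    rw [Bool.eq_iff_iff, key s hs, key t ht, hst]

end LargeCardinal

namespace LargeCardinal

open Cardinal Ordinal Set FirstOrder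

/-! ### Uniformly first-order predicates -/

/-- A predicate of tuples of elements of classes `q` is first-order if a single formula of the
language of set theory defines it in all the structures `⟨q, ∈⟩`. -/
def FO {α : Type} (P : ∀ q : ZFSet.{u} → Prop, (α → Subtype q) → Prop) : Prop :=
  ∃ φ : setLang.Formula α, ∀ (q : ZFSet.{u} → Prop) (v : α → Subtype q), φ.Realize v ↔ P q v

namespace FO

variable {α : Type} {P Q : ∀ q : ZFSet.{u} → Prop, (α → Subtype q) → Prop}

theorem mem (i j : α) : FO.{u} fun _ v => (v i).1 ∈ (v j).1 :=
  let r : setLang.Relations 2 := MemRel.mem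
  ⟨r.formula₂ (Language.Term.var i) (Language.Term.var j), fun q v => by
    refine Language.Formula.realize_rel₂.trans ?_
    exact relMap_mem _⟩

theorem eq (i j : α) : FO.{u} fun _ v => v i = v j :=
  ⟨(Language.Term.var i).equal (Language.Term.var j), fun q v => by
    rw [Language.Formula.realize_equal]; rfl⟩

theorem not (hP : FO P) : FO fun q v => ¬ P q v := by
  obtain ⟨φ, hφ⟩ := hP
  exact ⟨φ.not, fun q v => by rw [Language.Formula.realize_not, hφ]⟩

theorem imp (hP : FO P) (hQ : FO Q) : FO fun q v => P q v → Q q v := by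
  obtain ⟨φ, hφ⟩ := hP
  obtain ⟨ψ, hψ⟩ := hQ
  exact ⟨φ.imp ψ, fun q v => by rw [Language.Formula.realize_imp, hφ, hψ]⟩

theorem and (hP : FO P) (hQ : FO Q) : FO fun q v => P q v ∧ Q q v := by
  obtain ⟨φ, hφ⟩ := hP
  obtain ⟨ψ, hψ⟩ := hQ
  exact ⟨φ ⊓ ψ, fun q v => by rw [Language.Formula.realize_inf, hφ, hψ]⟩

theorem or (hP : FO P) (hQ : FO Q) : FO fun q v => P q v ∨ Q q v := by
  obtain ⟨φ, hφ⟩ := hP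
  obtain ⟨ψ, hψ⟩ := hQ
  exact ⟨φ ⊔ ψ, fun q v => by rw [Language.Formula.realize_sup, hφ, hψ]⟩

theorem iff (hP : FO P) (hQ : FO Q) : FO fun q v => P q v ↔ Q q v := by
  obtain ⟨φ, hφ⟩ := hP
  obtain ⟨ψ, hψ⟩ := hQ
  exact ⟨φ.iff ψ, fun q v => by rw [Language.Formula.realize_iff, hφ, hψ]⟩

/-- The quantified variable is the extra index `none`, which avoids bookkeeping with de Bruijn
indices. -/
theorem all {R : ∀ q : ZFSet.{u} → Prop, (α → Subtype q) → Subtype q → Prop}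
    (hR : FO fun q (w : Option α → Subtype q) => R q (fun i => w (some i)) (w none)) :
    FO fun q v => ∀ x, R q v x := by
  obtain ⟨φ, hφ⟩ := hR
  let g : Option α → α ⊕ Unit := fun o => o.elim (.inr ()) .inl
  refine ⟨(φ.relabel g).iAlls Unit, fun q v => ?_⟩
  rw [Language.Formula.realize_iAlls]
  simp only [Language.Formula.realize_relabel, hφ]
  exact ⟨fun h x => h fun _ => x, fun h x => h (x ())⟩

theorem ex {R : ∀ q : ZFSet.{u} → Prop, (α → Subtype q) → Subtype q → Prop}
    (hR : FO fun q (w : Option α → Subtype q) => R q (fun i => w (some i)) (w none)) :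
    FO fun q v => ∃ x, R q v x := by
  obtain ⟨φ, hφ⟩ := (all (R := fun q v x => ¬ R q v x) hR.not).not
  exact ⟨φ, fun q v => (hφ q v).trans not_forall_not⟩

/-- Elementary embeddings preserve first-order predicates. -/
theorem map (hP : FO P) {q q' : ZFSet.{u} → Prop} (j : Subtype q ↪ₑ[setLang] Subtype q')
    (v : α → Subtype q) : P q v ↔ P q' (j ∘ v) := by
  obtain ⟨φ, hφ⟩ := hP
  rw [← hφ, ← hφ, j.map_formula]

end FO

/-! ### Pairs, functions and the partition property inside a class of sets -/

section Internal

variable {q : ZFSet.{u} → Prop}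

/-- Inside `⟨q, ∈⟩`, `p` is the unordered pair `{a, b}`. -/
def UPair (p a b : Subtype q) : Prop := ∀ z : Subtype q, z.1 ∈ p.1 ↔ z = a ∨ z = b

/-- Inside `⟨q, ∈⟩`, `p` is the ordered pair of `a` and `b`. -/
def OPair (p a b : Subtype q) : Prop := ∃ s t, UPair s a a ∧ UPair t a b ∧ UPair p s t

/-- Inside `⟨q, ∈⟩`, the pair `(a, b)` belongs to `r`. -/
def Rel (r a b : Subtype q) : Prop := ∃ p, p.1 ∈ r.1 ∧ OPair p a b

/-- Inside `⟨q, ∈⟩`, the binary function `r` has value `z` at `(x, y)`. -/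
def App (r x y z : Subtype q) : Prop := ∃ p, OPair p x y ∧ Rel r p z

/-- Inside `⟨q, ∈⟩`, the set `a` is an ordinal. -/
def IsOrd (a : Subtype q) : Prop :=
  (∀ x : Subtype q, x.1 ∈ a.1 → ∀ y : Subtype q, y.1 ∈ x.1 → y.1 ∈ a.1) ∧
    ∀ x : Subtype q, x.1 ∈ a.1 → ∀ y : Subtype q, y.1 ∈ x.1 → ∀ z : Subtype q, z.1 ∈ y.1 →
      z.1 ∈ x.1

/-- Inside `⟨q, ∈⟩`, `p` satisfies the recursion that determines `pairCode` on `c`. -/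
def PairGraph (p c : Subtype q) : Prop :=
  ∀ a : Subtype q, a.1 ∈ c.1 → ∀ ξ : Subtype q, (ξ.1 ∈ a.1 ∨ ξ = a) → ∀ z, App p ξ a z ↔
    ∀ x : Subtype q, x.1 ∈ z.1 ↔ ∃ b η : Subtype q, (η.1 ∈ b.1 ∨ η = b) ∧
      (b.1 ∈ a.1 ∨ b = a ∧ η.1 ∈ ξ.1) ∧ App p η b x

/-- Inside `⟨q, ∈⟩`, `p` maps the pairs `(ξ, a)` with `ξ ≤ a < c` to ordinals in `[a, c)`. -/
def PairFun (p c : Subtype q) : Prop :=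
  ∀ a : Subtype q, a.1 ∈ c.1 → ∀ ξ : Subtype q, (ξ.1 ∈ a.1 ∨ ξ = a) → ∃ z : Subtype q,
    z.1 ∈ c.1 ∧ (∀ x : Subtype q, x.1 ∈ a.1 → x.1 ∈ z.1) ∧ App p ξ a z ∧
      ∀ z', App p ξ a z' → z' = z

/-- `EndHomogeneousAt S a` inside `⟨q, ∈⟩`; here `p` is the pairing function and `w` is `ω`. -/
def GoodIn (a S p w : Subtype q) : Prop :=
  w.1 ∈ a.1 ∧
  (∀ b : Subtype q, b.1 ∈ a.1 → ∀ ξ : Subtype q, (ξ.1 ∈ b.1 ∨ ξ = b) → ∀ z : Subtype q,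
    App p ξ b z → z.1 ∈ a.1) ∧
  ∀ k : Subtype q, k.1 ∈ w.1 → ∀ k' : Subtype q,
    (∀ x : Subtype q, x.1 ∈ k'.1 ↔ x.1 ∈ k.1 ∨ x = k) → ∀ ξ : Subtype q, ξ.1 ∈ a.1 →
      k'.1 ∈ ξ.1 → ∀ z, App p ξ a z → ∀ y, App p k z y → ∀ y', App p k' ξ y' →
        (y.1 ∈ S.1 ↔ y'.1 ∈ S.1)

/-- `EndHomogeneous ν` inside `⟨q, ∈⟩`; here `p` is the pairing function and `w` is `ω`. -/
def HomIn (ν p w : Subtype q) : Prop :=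
  ∀ F : Subtype q, (∀ x : Subtype q, x.1 ∈ F.1 → x.1 ∈ ν.1) → ∃ S X : Subtype q,
    (∀ x : Subtype q, x.1 ∈ X.1 → x.1 ∈ ν.1) ∧
    (∀ β : Subtype q, β.1 ∈ ν.1 → ∃ a : Subtype q, a.1 ∈ X.1 ∧ β.1 ∈ a.1) ∧
    (∀ a : Subtype q, a.1 ∈ X.1 → GoodIn a S p w) ∧
    ∀ e : Subtype q, (∀ x : Subtype q, ¬ x.1 ∈ e.1) → ∀ ξ : Subtype q, ξ.1 ∈ ν.1 → e.1 ∈ ξ.1 →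
      ∀ z, App p e ξ z → (z.1 ∈ S.1 ↔ ξ.1 ∈ F.1)

/-- Inside `⟨q, ∈⟩`, `S` consists of the codes of pairs `(k, ξ)` with `ξ ∈ s(k)`, `k < w`. -/
def JoinIn (S s p c w : Subtype q) : Prop :=
  ∀ z : Subtype q, z.1 ∈ S.1 ↔ z.1 ∈ c.1 ∧ ∃ k : Subtype q, k.1 ∈ w.1 ∧ ∃ y, Rel s k y ∧
    ∃ ξ : Subtype q, ξ.1 ∈ y.1 ∧ k.1 ∈ ξ.1 ∧ App p k ξ z

/-- Inside `⟨q, ∈⟩`, `F` is the `k`-th colouring coded by `S`, above `k`. -/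
def SectionIn (S F k c p : Subtype q) : Prop :=
  ∀ ξ : Subtype q, ξ.1 ∈ c.1 → k.1 ∈ ξ.1 → ∀ z, App p k ξ z → (z.1 ∈ S.1 ↔ ξ.1 ∈ F.1)

/-- Inside `⟨q, ∈⟩`, `X` is the set of all `a ∈ c` with `GoodIn a S p w`. -/
def GoodSet (X c S p w : Subtype q) : Prop :=
  ∀ a : Subtype q, a.1 ∈ X.1 ↔ a.1 ∈ c.1 ∧ GoodIn a S p w

/-- Inside `⟨q, ∈⟩`, `D` consists of the `ξ ∈ c` such that the code of `(ξ, c)` is in `F`. -/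
def DerivedSet (D c p F : Subtype q) : Prop :=
  ∀ x : Subtype q, x.1 ∈ D.1 ↔ x.1 ∈ c.1 ∧ ∃ z : Subtype q, z.1 ∈ F.1 ∧ App p x c z

end Internal

/-! ### First-order definability of the internal notions -/

namespace FO

variable {α : Type}

theorem oPair (p a b : α) : FO.{u} fun _ v => OPair (v p) (v a) (v b) := by
  unfold OPair UPair
  repeat' first
    | exact mem _ _ | exact eq _ _ | apply all | apply ex | apply and | apply or | apply iff

theorem rel (r a b : α) : FO.{u} fun _ v => Rel (v r) (v a) (v b) :=
  ex ((mem _ _).and (oPair _ _ _))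

theorem app (r x y z : α) : FO.{u} fun _ v => App (v r) (v x) (v y) (v z) :=
  ex ((oPair _ _ _).and (rel _ _ _))

theorem isOrd (a : α) : FO.{u} fun _ v => IsOrd (v a) := by
  unfold IsOrd
  repeat' first
    | exact mem _ _ | exact eq _ _ | apply all | apply and | apply imp

theorem pairGraph (p c : α) : FO.{u} fun _ v => PairGraph (v p) (v c) := by
  unfold PairGraph
  repeat' first
    | exact mem _ _ | exact eq _ _ | exact app _ _ _ _ | apply all | apply ex | apply and
    | apply or | apply iff | apply imp

theorem pairFun (p c : α) : FO.{u} fun _ v => PairFun (v p) (v c) := by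
  unfold PairFun
  repeat' first
    | exact mem _ _ | exact eq _ _ | exact app _ _ _ _ | apply all | apply ex | apply and
    | apply or | apply iff | apply imp

theorem goodIn (a S p w : α) : FO.{u} fun _ v => GoodIn (v a) (v S) (v p) (v w) := by
  unfold GoodIn
  repeat' first
    | exact mem _ _ | exact eq _ _ | exact app _ _ _ _ | apply all | apply ex | apply and
    | apply or | apply iff | apply imp

theorem homIn (ν p w : α) : FO.{u} fun _ v => HomIn (v ν) (v p) (v w) := by
  unfold HomIn
  repeat' first
    | exact mem _ _ | exact eq _ _ | exact app _ _ _ _ | exact goodIn _ _ _ _ | apply all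
    | apply not | apply ex | apply and | apply or | apply iff | apply imp

theorem joinIn (S s p c w : α) :
    FO.{u} fun _ v => JoinIn (v S) (v s) (v p) (v c) (v w) := by
  unfold JoinIn
  repeat' first
    | exact mem _ _ | exact app _ _ _ _ | exact rel _ _ _ | apply all | apply ex | apply and
    | apply iff

theorem sectionIn (S F k c p : α) :
    FO.{u} fun _ v => SectionIn (v S) (v F) (v k) (v c) (v p) := by
  unfold SectionIn
  repeat' first
    | exact mem _ _ | exact app _ _ _ _ | apply all | apply iff | apply imp

theorem goodSet (X c S p w : α) :
    FO.{u} fun _ v => GoodSet (v X) (v c) (v S) (v p) (v w) :=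
  all ((mem _ _).iff ((mem _ _).and (goodIn _ _ _ _)))

theorem derivedSet (D c p F : α) :
    FO.{u} fun _ v => DerivedSet (v D) (v c) (v p) (v F) :=
  all ((mem _ _).iff ((mem _ _).and (ex ((mem _ _).and (app _ _ _ _)))))

end FO

/-! ### Transfer along elementary embeddings -/

section Transfer

variable {q q' : ZFSet.{u} → Prop} (j : Subtype q ↪ₑ[setLang] Subtype q')

theorem mem_map_iff (a b : Subtype q) : a.1 ∈ b.1 ↔ (j a).1 ∈ (j b).1 :=
  (FO.mem (α := Fin 2) 0 1).map j ![a, b]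

theorem subset_map_iff (a b : Subtype q) : (∀ x : Subtype q, x.1 ∈ a.1 → x.1 ∈ b.1) ↔
    ∀ x : Subtype q', x.1 ∈ (j a).1 → x.1 ∈ (j b).1 :=
  (FO.all (α := Fin 2) (R := fun _ v x => x.1 ∈ (v 0).1 → x.1 ∈ (v 1).1)
    ((FO.mem _ _).imp (FO.mem _ _))).map j ![a, b]

theorem app_map_iff (r x y z : Subtype q) : App r x y z ↔ App (j r) (j x) (j y) (j z) :=
  (FO.app (α := Fin 4) 0 1 2 3).map j ![r, x, y, z]

theorem isOrd_map_iff (a : Subtype q) : IsOrd a ↔ IsOrd (j a) :=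
  (FO.isOrd (α := Fin 1) 0).map j ![a]

theorem pairFun_map_iff (p c : Subtype q) : PairFun p c ↔ PairFun (j p) (j c) :=
  (FO.pairFun (α := Fin 2) 0 1).map j ![p, c]

theorem exists_pairGraph_map_iff (c : Subtype q) :
    (∃ p, PairGraph p c) ↔ ∃ p, PairGraph p (j c) :=
  (FO.ex (α := Fin 1) (R := fun _ v p => PairGraph p (v 0)) (FO.pairGraph _ _)).map j ![c]

theorem pairGraph_map_iff (p c : Subtype q) : PairGraph p c ↔ PairGraph (j p) (j c) :=
  (FO.pairGraph (α := Fin 2) 0 1).map j ![p, c]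

theorem exists_joinIn_map_iff (s p c w : Subtype q) :
    (∃ S, JoinIn S s p c w) ↔ ∃ S, JoinIn S (j s) (j p) (j c) (j w) :=
  (FO.ex (α := Fin 4) (R := fun _ v S => JoinIn S (v 0) (v 1) (v 2) (v 3))
    (FO.joinIn _ _ _ _ _)).map j ![s, p, c, w]

theorem sectionIn_map_iff (S F k c p : Subtype q) :
    SectionIn S F k c p ↔ SectionIn (j S) (j F) (j k) (j c) (j p) :=
  (FO.sectionIn (α := Fin 5) 0 1 2 3 4).map j ![S, F, k, c, p]

theorem exists_goodSet_map_iff (c S p w : Subtype q) :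
    (∃ X, GoodSet X c S p w) ↔ ∃ X, GoodSet X (j c) (j S) (j p) (j w) :=
  (FO.ex (α := Fin 4) (R := fun _ v X => GoodSet X (v 0) (v 1) (v 2) (v 3))
    (FO.goodSet _ _ _ _ _)).map j ![c, S, p, w]

theorem goodSet_map_iff (X c S p w : Subtype q) :
    GoodSet X c S p w ↔ GoodSet (j X) (j c) (j S) (j p) (j w) :=
  (FO.goodSet (α := Fin 5) 0 1 2 3 4).map j ![X, c, S, p, w]

theorem exists_mem_gt_map_iff (X β : Subtype q) :
    (∃ a : Subtype q, a.1 ∈ X.1 ∧ β.1 ∈ a.1) ↔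
      ∃ a : Subtype q', a.1 ∈ (j X).1 ∧ (j β).1 ∈ a.1 :=
  (FO.ex (α := Fin 2) (R := fun _ v a => a.1 ∈ (v 0).1 ∧ (v 1).1 ∈ a.1)
    ((FO.mem _ _).and (FO.mem _ _))).map j ![X, β]

theorem exists_homIn_map_iff (c μ p w : Subtype q) :
    (∃ ν : Subtype q, ν.1 ∈ c.1 ∧ μ.1 ∈ ν.1 ∧ HomIn ν p w) ↔
      ∃ ν : Subtype q', ν.1 ∈ (j c).1 ∧ (j μ).1 ∈ ν.1 ∧ HomIn ν (j p) (j w) :=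
  (FO.ex (α := Fin 4)
    (R := fun _ v ν => ν.1 ∈ (v 0).1 ∧ (v 1).1 ∈ ν.1 ∧ HomIn ν (v 2) (v 3))
    ((FO.mem _ _).and ((FO.mem _ _).and (FO.homIn _ _ _)))).map j ![c, μ, p, w]

end Transfer

/-- The parameters are quantified because N needs this instance of separation at κ, which need not
be of the form j(c). -/
theorem forall_exists_derivedSet_map_iff {q q' : ZFSet.{u} → Prop}
    (j : Subtype q ↪ₑ[setLang] Subtype q') :
    (∀ c p F : Subtype q, ∃ D, DerivedSet D c p F) ↔
      ∀ c p F : Subtype q', ∃ D, DerivedSet D c p F :=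
  (FO.all (α := Fin 0) (R := fun _ _ c => ∀ p F, ∃ D, DerivedSet D c p F)
    (FO.all (FO.all (FO.ex (FO.derivedSet _ _ _ _))))).map j ![]

theorem isOrd_trichotomy_map_iff {q q' : ZFSet.{u} → Prop}
    (j : Subtype q ↪ₑ[setLang] Subtype q') :
    (∀ a b : Subtype q, IsOrd a → IsOrd b → a.1 ∈ b.1 ∨ a = b ∨ b.1 ∈ a.1) ↔
      ∀ a b : Subtype q', IsOrd a → IsOrd b → a.1 ∈ b.1 ∨ a = b ∨ b.1 ∈ a.1 :=
  (FO.all (α := Fin 0)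
    (R := fun _ _ a => ∀ b, IsOrd a → IsOrd b → a.1 ∈ b.1 ∨ a = b ∨ b.1 ∈ a.1)
    (FO.all ((FO.isOrd _).imp ((FO.isOrd _).imp
      ((FO.mem _ _).or ((FO.eq _ _).or (FO.mem _ _))))))).map j ![]

end LargeCardinal

namespace LargeCardinal

open Cardinal Ordinal Set FirstOrder ZFSet

/-! ### Evaluation in classes like `H(θ)` -/

/-- The closure properties of `H(θ)`, for `θ` large compared to `κ`. -/
structure Ambient (κ : Cardinal.{u}) (q : ZFSet.{u} → Prop) : Prop where
  of_mem : ∀ {x y : ZFSet.{u}}, x ∈ y → q y → q x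
  of_subset : ∀ {x y : ZFSet.{u}}, x ⊆ y → q y → q x
  of_subset_vonNeumann : ∀ {x : ZFSet.{u}}, x ⊆ vonNeumann κ.ord → q x

/-- All ordinals below `κ` are in `q`, and there `p` is the pairing function. -/
structure Adequate (κ : Cardinal.{u}) {q : ZFSet.{u} → Prop} (p : Subtype q) : Prop where
  mem : ∀ o < κ.ord, q o.toZFSet
  app_iff : ∀ {x o : Ordinal.{u}}, x ≤ o → o < κ.ord → ∀ {ξ a : Subtype q}, ξ.1 = x.toZFSet →
    a.1 = o.toZFSet → ∀ z, App p ξ a z ↔ z.1 = (pairCode x o).toZFSet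

theorem ambient_H {κ θ : Cardinal.{u}}
    (h : (vonNeumann κ.ord).card < θ) : Ambient κ (· ∈ H θ) where
  of_mem := by
    rintro x y hxy ⟨t, ht, hyt, hc⟩
    exact ⟨t, ht, ht x (hyt hxy), hc⟩
  of_subset := by
    rintro x y hxy ⟨t, ht, hyt, hc⟩
    exact ⟨t, ht, fun _ hz => hyt (hxy hz), hc⟩
  of_subset_vonNeumann := fun hx => ⟨_, isTransitive_vonNeumann _, hx, h⟩

theorem exists_of_mem_toZFSet {o : Ordinal.{u}} {x : ZFSet.{u}} (h : x ∈ o.toZFSet) :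
    ∃ a < o, x = a.toZFSet := by
  obtain ⟨a, ha, rfl⟩ := mem_toZFSet_iff.1 h
  exact ⟨a, ha, rfl⟩

theorem exists_of_mem_or_eq {q : ZFSet.{u} → Prop} {o : Ordinal.{u}} {x y : Subtype q}
    (hy : y.1 = o.toZFSet) (h : x.1 ∈ y.1 ∨ x = y) : ∃ a ≤ o, x.1 = a.toZFSet := by
  rcases h with h | rfl
  · obtain ⟨a, ha, h⟩ := exists_of_mem_toZFSet (hy ▸ h)
    exact ⟨a, ha.le, h⟩
  · exact ⟨o, le_rfl, hy⟩

theorem mem_or_eq_of_le {q : ZFSet.{u} → Prop} {a o : Ordinal.{u}} {x y : Subtype q}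
    (hx : x.1 = a.toZFSet) (hy : y.1 = o.toZFSet) (h : a ≤ o) : x.1 ∈ y.1 ∨ x = y := by
  rcases h.lt_or_eq with h | rfl
  · exact .inl (by rw [hx, hy]; exact toZFSet_mem_toZFSet_iff.2 h)
  · exact .inr (Subtype.ext (hx.trans hy.symm))

/-! ### Absoluteness and separation in classes like H(θ) -/

namespace Ambient

variable {κ : Cardinal.{u}} {q : ZFSet.{u} → Prop} (h : Ambient κ q)
include h

theorem toZFSet_mem {o : Ordinal.{u}} (ho : o ≤ κ.ord) : q o.toZFSet :=
  h.of_subset_vonNeumann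
    ((toZFSet_subset_vonNeumann o).trans (vonNeumann_subset_of_le ho))

theorem uPair_iff (p a b : Subtype q) : UPair p a b ↔ p.1 = {a.1, b.1} := by
  constructor
  · intro hp
    ext z
    rw [ZFSet.mem_pair]
    constructor
    · intro hz
      exact ((hp ⟨z, h.of_mem hz p.2⟩).1 hz).imp (congrArg Subtype.val) (congrArg Subtype.val)
    · rintro (rfl | rfl)
      · exact (hp a).2 (.inl rfl)
      · exact (hp b).2 (.inr rfl)
  · intro hp z
    rw [hp, ZFSet.mem_pair, Subtype.ext_iff, Subtype.ext_iff]

theorem oPair_iff (p a b : Subtype q) : OPair p a b ↔ p.1 = ZFSet.pair a.1 b.1 := by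
  constructor
  · rintro ⟨s, t, hs, ht, hp⟩
    rw [h.uPair_iff] at hs ht hp
    rw [hp, hs, ht, ZFSet.pair, ZFSet.pair_eq_singleton]
  · intro hp
    have hs : ({a.1} : ZFSet) ∈ p.1 := by rw [hp, ZFSet.pair]; simp
    have ht : ({a.1, b.1} : ZFSet) ∈ p.1 := by rw [hp, ZFSet.pair]; simp
    refine ⟨⟨_, h.of_mem hs p.2⟩, ⟨_, h.of_mem ht p.2⟩, ?_, ?_, ?_⟩ <;> rw [h.uPair_iff]
    · simp
    · exact hp

theorem rel_iff (r a b : Subtype q) : Rel r a b ↔ ZFSet.pair a.1 b.1 ∈ r.1 := by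
  constructor
  · rintro ⟨p, hp, hab⟩
    rwa [← (h.oPair_iff _ _ _).1 hab]
  · intro hp
    exact ⟨⟨_, h.of_mem hp r.2⟩, hp, (h.oPair_iff _ _ _).2 rfl⟩

theorem app_iff (r x y z : Subtype q) :
    App r x y z ↔ ZFSet.pair (ZFSet.pair x.1 y.1) z.1 ∈ r.1 := by
  constructor
  · rintro ⟨p, hp, hr⟩
    rwa [h.rel_iff, (h.oPair_iff _ _ _).1 hp] at hr
  · intro hp
    have h1 : q ({ZFSet.pair x.1 y.1} : ZFSet) :=
      h.of_mem (y := ZFSet.pair (ZFSet.pair x.1 y.1) z.1) (by rw [ZFSet.pair]; simp)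
        (h.of_mem hp r.2)
    have h2 : q (ZFSet.pair x.1 y.1) := h.of_mem (ZFSet.mem_singleton.2 rfl) h1
    exact ⟨⟨_, h2⟩, (h.oPair_iff _ _ _).2 rfl, (h.rel_iff _ _ _).2 hp⟩

theorem isOrd_iff (a : Subtype q) : IsOrd a ↔ a.1.IsOrdinal := by
  rw [isOrdinal_iff_forall_mem_isTransitive]
  constructor
  · rintro ⟨h1, h2⟩
    have hq : ∀ {x : ZFSet}, x ∈ a.1 → q x := fun hx => h.of_mem hx a.2
    refine ⟨fun x hx y hy => h1 ⟨x, hq hx⟩ hx ⟨y, h.of_mem hy (hq hx)⟩ hy, ?_⟩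
    intro x hx y hy z hz
    exact h2 ⟨x, hq hx⟩ hx ⟨y, h.of_mem hy (hq hx)⟩ hy
      ⟨z, h.of_mem hz (h.of_mem hy (hq hx))⟩ hz
  · rintro ⟨h1, h2⟩
    exact ⟨fun x hx y hy => h1 _ hx hy, fun x hx y hy z hz => h2 _ hx _ hy hz⟩

omit h in
-- One step of the recursion in `PairGraph`, assuming p correct on smaller pairs. It serves both the
-- existence and the correctness of p.
theorem exists_pair_iff_mem {p : Subtype q} {x o : Ordinal.{u}} (hxo : x ≤ o)
    (hq : ∀ b ≤ o, q b.toZFSet)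
    (hp : ∀ b η : Ordinal.{u}, η ≤ b → (b < o ∨ b = o ∧ η < x) → ∀ s t : Subtype q,
      s.1 = η.toZFSet → t.1 = b.toZFSet → ∀ z, App p s t z ↔ z.1 = (pairCode η b).toZFSet)
    {ξ a : Subtype q} (hξ : ξ.1 = x.toZFSet) (ha : a.1 = o.toZFSet) (y : Subtype q) :
    (∃ b η : Subtype q, (η.1 ∈ b.1 ∨ η = b) ∧ (b.1 ∈ a.1 ∨ b = a ∧ η.1 ∈ ξ.1) ∧ App p η b y) ↔
      y.1 ∈ (pairCode x o).toZFSet := by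
  constructor
  · rintro ⟨b, η, h1, h2, h3⟩
    obtain ⟨β, hβ, hb⟩ := exists_of_mem_or_eq ha (h2.imp_right And.left)
    obtain ⟨e, he, hη⟩ := exists_of_mem_or_eq hb h1
    have h2' : β < o ∨ β = o ∧ e < x := by
      refine h2.imp (fun h => ?_) fun h => ⟨?_, ?_⟩
      · rwa [ha, hb, toZFSet_mem_toZFSet_iff] at h
      · exact toZFSet_injective (by rw [← hb, ← ha, h.1])
      · have := h.2
        rwa [hη, hξ, toZFSet_mem_toZFSet_iff] at this
    rw [(hp β e he h2' _ _ hη hb _).1 h3, toZFSet_mem_toZFSet_iff]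
    exact pairCode_lt_pairCode he h2'
  · intro hy
    obtain ⟨t, ht, hyt⟩ := exists_of_mem_toZFSet hy
    obtain ⟨b, η, hη, hlt, rfl⟩ := (lt_pairCode_iff hxo).1 ht
    have hbo : b ≤ o := hlt.elim le_of_lt fun h => h.1.le
    refine ⟨⟨_, hq b hbo⟩, ⟨_, hq η (hη.trans hbo)⟩, mem_or_eq_of_le rfl rfl hη, ?_,
      (hp b η hη hlt _ _ rfl rfl _).2 hyt⟩
    refine hlt.imp (fun h => ?_) fun h => ⟨?_, ?_⟩
    · rw [ha]; exact toZFSet_mem_toZFSet_iff.2 h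
    · exact Subtype.ext ((congrArg toZFSet h.1).trans ha.symm)
    · rw [hξ]; exact toZFSet_mem_toZFSet_iff.2 h.2

theorem forall_mem_iff_iff (z : Subtype q) {y : ZFSet.{u}} (hy : q y) :
    (∀ x : Subtype q, x.1 ∈ z.1 ↔ x.1 ∈ y) ↔ z.1 = y := by
  constructor
  · intro hz
    ext x
    exact ⟨fun hx => (hz ⟨x, h.of_mem hx z.2⟩).1 hx, fun hx => (hz ⟨x, h.of_mem hx hy⟩).2 hx⟩
  · rintro rfl x
    rfl

/-- Closure under subsets allows an arbitrary P. The instances of separation used in M and N come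
from here by elementarity. -/
theorem exists_sep (P : Subtype q → Prop) (c : Subtype q) :
    ∃ b : Subtype q, ∀ x : Subtype q, x.1 ∈ b.1 ↔ x.1 ∈ c.1 ∧ P x := by
  refine ⟨⟨ZFSet.sep (fun x => ∃ hx, P ⟨x, hx⟩) c.1, h.of_subset ZFSet.sep_subset c.2⟩, ?_⟩
  intro x
  rw [ZFSet.mem_sep]
  exact ⟨fun ⟨h1, h2, h3⟩ => ⟨h1, h3⟩, fun ⟨h1, h3⟩ => ⟨h1, x.2, h3⟩⟩

theorem adequate_of_pairGraph (hκ : κ.IsRegular) {p c : Subtype q} (hc : c.1 = cardSet κ)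
    (hp : PairGraph p c) : Adequate κ p := by
  have hq : ∀ o < κ.ord, q o.toZFSet := fun o ho => h.toZFSet_mem ho.le
  refine ⟨hq, ?_⟩
  suffices ∀ o, ∀ x ≤ o, o < κ.ord → ∀ ξ a : Subtype q, ξ.1 = x.toZFSet → a.1 = o.toZFSet → ∀ z,
      (App p ξ a z ↔ z.1 = (pairCode x o).toZFSet) from
    fun {x o} hx ho {ξ a} hξ ha z => this o x hx ho ξ a hξ ha z
  intro o
  induction o using WellFoundedLT.induction with
  | ind o iho =>
    intro x
    induction x using WellFoundedLT.induction with
    | ind x ihx =>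
      intro hxo ho ξ a hξ ha z
      have hac : a.1 ∈ c.1 := by
        rw [ha, hc]; exact toZFSet_mem_toZFSet_iff.2 ho
      rw [hp a hac ξ (mem_or_eq_of_le hξ ha hxo) z,
        ← h.forall_mem_iff_iff z (hq _ (pairCode_lt_ord hκ hxo ho))]
      refine forall_congr' fun y => iff_congr Iff.rfl ?_
      refine exists_pair_iff_mem hxo (fun b hb => hq b (hb.trans_lt ho)) ?_ hξ ha y
      rintro b η hη (hb | ⟨rfl, hηx⟩) s t hs ht z
      · exact iho b hb η hη (hb.trans ho) s t hs ht z
      · exact ihx η hηx hη ho s t hs ht z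

theorem exists_pairGraph (hκ : κ.IsRegular) {c : Subtype q} (hc : c.1 = cardSet κ) :
    ∃ p : Subtype q, PairGraph p c := by
  have hq : ∀ o < κ.ord, q o.toZFSet := fun o ho => h.toZFSet_mem ho.le
  let g : ZFSet.{u} := ZFSet.sep (fun z => ∃ x a : Ordinal.{u}, x ≤ a ∧ a < κ.ord ∧
    z = ZFSet.pair (ZFSet.pair x.toZFSet a.toZFSet) (pairCode x a).toZFSet) (vonNeumann κ.ord)
  have hg : ∀ x a : Ordinal.{u}, x ≤ a → a < κ.ord → ∀ z, (ZFSet.pair (ZFSet.pair x.toZFSet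
      a.toZFSet) z ∈ g ↔ z = (pairCode x a).toZFSet) := by
    intro x a hxa ha z
    rw [ZFSet.mem_sep]
    constructor
    · rintro ⟨-, x', a', -, -, heq⟩
      obtain ⟨h1, rfl⟩ := ZFSet.pair_inj.1 heq
      obtain ⟨h2, h3⟩ := ZFSet.pair_inj.1 h1
      rw [toZFSet_injective h2, toZFSet_injective h3]
    · rintro rfl
      refine ⟨?_, x, a, hxa, ha, rfl⟩
      have hlim : ∀ o < κ.ord, o + 1 < κ.ord := fun o ho =>
        (isSuccLimit_ord hκ.aleph0_le).add_one_lt ho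
      have hpair : ∀ y z, y ∈ vonNeumann κ.ord → z ∈ vonNeumann κ.ord →
          ({y, z} : ZFSet) ∈ vonNeumann κ.ord := by
        intro y z hy hz
        rw [mem_vonNeumann] at *
        rw [rank_pair]
        exact max_lt (hlim _ hy) (hlim _ hz)
      have hopair : ∀ y z, y ∈ vonNeumann κ.ord → z ∈ vonNeumann κ.ord →
          ZFSet.pair y z ∈ vonNeumann κ.ord := by
        intro y z hy hz
        rw [ZFSet.pair, ← ZFSet.pair_eq_singleton]
        exact hpair _ _ (hpair _ _ hy hy) (hpair _ _ hy hz)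
      have hord : ∀ o < κ.ord, o.toZFSet ∈ vonNeumann κ.ord := fun o ho => by
        rwa [mem_vonNeumann, rank_toZFSet]
      exact hopair _ _ (hopair _ _ (hord x (hxa.trans_lt ha)) (hord a ha))
        (hord _ (pairCode_lt_ord hκ hxa ha))
  refine ⟨⟨g, h.of_subset_vonNeumann ZFSet.sep_subset⟩, ?_⟩
  have happ : ∀ x o : Ordinal.{u}, x ≤ o → o < κ.ord → ∀ ξ a : Subtype q, ξ.1 = x.toZFSet →
      a.1 = o.toZFSet → ∀ z, (App ⟨g, h.of_subset_vonNeumann ZFSet.sep_subset⟩ ξ a z ↔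
        z.1 = (pairCode x o).toZFSet) := by
    intro x o hx ho ξ a hξ ha z
    rw [h.app_iff, hξ, ha]
    exact hg x o hx ho z.1
  intro a ha ξ hξa z
  obtain ⟨o, ho, hao⟩ := exists_of_mem_toZFSet (hc ▸ ha)
  obtain ⟨x, hxo, hξ⟩ := exists_of_mem_or_eq hao hξa
  rw [happ x o hxo ho ξ a hξ hao,
    ← h.forall_mem_iff_iff z (hq _ (pairCode_lt_ord hκ hxo ho))]
  refine forall_congr' fun y => iff_congr Iff.rfl (Iff.symm ?_)
  refine exists_pair_iff_mem hxo (fun b hb => hq b (hb.trans_lt ho)) ?_ hξ hao y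
  intro b η hη hb s t hs ht z
  exact happ η b hη (hb.elim (·.trans ho) fun h => h.1 ▸ ho) s t hs ht z

end Ambient

/-! ### Evaluating the internal notions on ordinals below κ -/

namespace Adequate

variable {κ : Cardinal.{u}} {q : ZFSet.{u} → Prop} {p : Subtype q} (h : Adequate κ p)
  (hκ : κ.IsRegular)
include h hκ

theorem pairFun {c : Subtype q} (hc : c.1 = cardSet κ) : PairFun p c := by
  intro a ha ξ hξ
  obtain ⟨o, ho, hao⟩ := exists_of_mem_toZFSet (hc ▸ ha)
  obtain ⟨x, hxo, hξ⟩ := exists_of_mem_or_eq hao hξ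
  have hlt := pairCode_lt_ord hκ hxo ho
  refine ⟨⟨_, h.mem _ hlt⟩, ?_, ?_, (h.app_iff hxo ho hξ hao _).2 rfl, ?_⟩
  · rw [hc]; exact toZFSet_mem_toZFSet_iff.2 hlt
  · intro y hy
    rw [hao] at hy
    exact toZFSet_subset_toZFSet_iff.2 (le_pairCode x o) hy
  · intro z hz
    exact Subtype.ext ((h.app_iff hxo ho hξ hao z).1 hz)

/-- Only ordinals below κ are involved, and there p is correct. Hence M, N and the universe agree on
end-homogeneity. -/
theorem goodIn_iff {a S w : Subtype q} {o : Ordinal.{u}} (ho : o < κ.ord) (ha : a.1 = o.toZFSet)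
    (hw : w.1 = toZFSet ω) : GoodIn a S p w ↔ EndHomogeneousAt {x | x.toZFSet ∈ S.1} o := by
  have hpc : ∀ {x b : Ordinal.{u}}, x ≤ b → b < κ.ord → pairCode x b < κ.ord := fun h1 h2 =>
    pairCode_lt_ord hκ h1 h2
  constructor
  · rintro ⟨h1, h2, h3⟩
    rw [ha] at h1 h2 h3
    rw [hw] at h1 h3
    refine ⟨toZFSet_mem_toZFSet_iff.1 h1, fun b hb ξ hξ => ?_, fun k ξ hξ hk => ?_⟩
    · have hb' := hb.trans ho
      have := h2 ⟨_, h.mem b hb'⟩ (toZFSet_mem_toZFSet_iff.2 hb) ⟨_, h.mem ξ (hξ.trans_lt hb')⟩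
        (mem_or_eq_of_le rfl rfl hξ) ⟨_, h.mem _ (hpc hξ hb')⟩
        ((h.app_iff hξ hb' rfl rfl _).2 rfl)
      exact toZFSet_mem_toZFSet_iff.1 this
    · have hk' : (k : Ordinal.{u}) < ξ := (le_self_add).trans_lt hk
      have hξ' := hξ.trans ho
      have hkz : (k : Ordinal.{u}) ≤ pairCode ξ o := (hk'.trans hξ).le.trans (le_pairCode _ _)
      exact h3 ⟨_, h.mem k (hk'.trans hξ')⟩ (toZFSet_mem_toZFSet_iff.2 (natCast_lt_omega0 k))
        ⟨_, h.mem (k + 1) (hk.trans hξ')⟩ (fun x => by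
          change x.1 ∈ toZFSet (k + 1) ↔ _
          rw [toZFSet_add_one, ZFSet.mem_insert_iff, or_comm, Subtype.ext_iff])
        ⟨_, h.mem ξ hξ'⟩ (toZFSet_mem_toZFSet_iff.2 hξ) (toZFSet_mem_toZFSet_iff.2 hk)
        ⟨_, h.mem _ (hpc hξ.le ho)⟩ ((h.app_iff hξ.le ho rfl ha _).2 rfl)
        ⟨_, h.mem _ (hpc hkz (hpc hξ.le ho))⟩
        ((h.app_iff hkz (hpc hξ.le ho) rfl rfl _).2 rfl)
        ⟨_, h.mem _ (hpc hk.le hξ')⟩ ((h.app_iff hk.le hξ' rfl rfl _).2 rfl)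
  · rintro ⟨h1, h2, h3⟩
    refine ⟨?_, ?_, ?_⟩
    · rw [hw, ha]
      exact toZFSet_mem_toZFSet_iff.2 h1
    · intro b hb ξ hξ z hz
      rw [ha] at hb
      obtain ⟨β, hβ, hb⟩ := exists_of_mem_toZFSet hb
      obtain ⟨x, hx, hξ⟩ := exists_of_mem_or_eq hb hξ
      rw [(h.app_iff hx (hβ.trans ho) hξ hb z).1 hz, ha]
      exact toZFSet_mem_toZFSet_iff.2 (h2 β hβ x hx)
    · intro k hk k' hk' ξ hξ hkξ z hz y hy y' hy'
      rw [hw] at hk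
      obtain ⟨n', hn, hk⟩ := exists_of_mem_toZFSet hk
      obtain ⟨n, rfl⟩ := lt_omega0.1 hn
      rw [ha] at hξ
      obtain ⟨x, hx, hξ⟩ := exists_of_mem_toZFSet hξ
      rw [hξ] at hkξ
      obtain ⟨m, hm, hkm⟩ := exists_of_mem_toZFSet hkξ
      -- A priori k' is a successor only in the sense of q, but it is a true ordinal and q contains
      -- all ordinals below κ.
      have hmn : m = n + 1 := by
        refine le_antisymm (le_of_forall_lt fun i hi => ?_) (Order.add_one_le_of_lt ?_)
        · have := (hk' ⟨_, h.mem i (hi.trans (hm.trans (hx.trans ho)))⟩).1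
            (by rw [hkm]; exact toZFSet_mem_toZFSet_iff.2 hi)
          rw [Order.lt_add_one_iff]
          rcases this with h | h
          · rw [hk] at h
            exact (toZFSet_mem_toZFSet_iff.1 h).le
          · exact (toZFSet_injective ((congrArg Subtype.val h).trans hk)).le
        · have := (hk' k).2 (.inr rfl)
          rw [hk, hkm] at this
          exact toZFSet_mem_toZFSet_iff.1 this
      subst hmn
      have hn : (n : Ordinal.{u}) < x := (le_self_add).trans_lt hm
      have hnz : (n : Ordinal.{u}) ≤ pairCode x o := (hn.trans hx).le.trans (le_pairCode _ _)
      have hz := (h.app_iff hx.le ho hξ ha z).1 hz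
      rw [(h.app_iff hnz (hpc hx.le ho) hk hz y).1 hy,
        (h.app_iff hm.le (hx.trans ho) hkm hξ y').1 hy']
      exact h3 n x hx hm

/-- Since q is closed under subsets, it contains every colouring of ν. -/
theorem endHomogeneous_of_homIn (hq : Ambient κ q) {ν w : Subtype q} {o : Ordinal.{u}}
    (ho : o < κ.ord) (hν : ν.1 = o.toZFSet) (hw : w.1 = toZFSet ω) (hom : HomIn ν p w) :
    EndHomogeneous o := by
  intro F hF
  let F' : ZFSet.{u} := ZFSet.sep (fun z => ∃ x ∈ F, z = x.toZFSet) o.toZFSet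
  have hF' : ∀ x < o, (x.toZFSet ∈ F' ↔ x ∈ F) := fun x hx => by
    rw [ZFSet.mem_sep]
    constructor
    · rintro ⟨-, y, hy, hxy⟩
      rwa [toZFSet_injective hxy]
    · exact fun hxF => ⟨toZFSet_mem_toZFSet_iff.2 hx, x, hxF, rfl⟩
  have hqo : q o.toZFSet := h.mem o ho
  obtain ⟨S, X, h1, h2, h3, h4⟩ := hom ⟨F', hq.of_subset ZFSet.sep_subset hqo⟩ fun x hx => by
    rw [hν]
    exact (ZFSet.mem_sep.1 (show x.1 ∈ F' from hx)).1
  rw [hν] at h1 h2 h4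
  have hX : ∀ {x : ZFSet}, x ∈ X.1 → q x := fun hx => hq.of_mem hx X.2
  refine ⟨{x | x.toZFSet ∈ S.1}, {x | x.toZFSet ∈ X.1}, ?_, ?_, ?_, ?_⟩
  · intro x hx
    exact toZFSet_mem_toZFSet_iff.1 (h1 ⟨_, hX hx⟩ hx)
  · intro β hβ
    obtain ⟨a, ha, hβa⟩ := h2 ⟨_, h.mem β (hβ.trans ho)⟩ (toZFSet_mem_toZFSet_iff.2 hβ)
    obtain ⟨b, -, hb⟩ := exists_of_mem_toZFSet (h1 a ha)
    refine ⟨b, ?_, ?_⟩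
    · rw [hb] at ha
      exact ha
    · rw [hb] at hβa
      exact toZFSet_mem_toZFSet_iff.1 hβa
  · intro a ha
    have ha' : a.toZFSet ∈ X.1 := ha
    have hao := toZFSet_mem_toZFSet_iff.1 (h1 ⟨_, hX ha'⟩ ha')
    exact (h.goodIn_iff hκ (hao.trans ho) rfl hw).1 (h3 ⟨_, hX ha'⟩ ha')
  · intro ξ hξ h0
    have h00 := h0.trans (hξ.trans ho)
    rw [← hF' ξ hξ]
    refine h4 ⟨_, h.mem 0 h00⟩ (fun x => ?_) ⟨_, h.mem ξ (hξ.trans ho)⟩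
      (toZFSet_mem_toZFSet_iff.2 hξ) (toZFSet_mem_toZFSet_iff.2 h0)
      ⟨_, h.mem _ (pairCode_lt_ord hκ h0.le (hξ.trans ho))⟩
      ((h.app_iff h0.le (hξ.trans ho) rfl rfl _).2 rfl)
    simp

end Adequate

end LargeCardinal

namespace LargeCardinal

open Cardinal Ordinal Set FirstOrder ZFSet

/-! ### Powerset preserving embeddings of countably closed models -/

/-- A model `M` elementary in a class `q` like `H(θ)`, with a `κ`-powerset preserving elementary
embedding `j : M → N`. -/
structure PreservingSetting (κ : Cardinal.{u}) {q : ZFSet.{u} → Prop} {M N : ZFSet.{u}}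
    (i : M ↪ₑ[setLang] Subtype q) (j : M ↪ₑ[setLang] N) : Prop where
  ambient : Ambient κ q
  regular : κ.IsRegular
  omega_lt : ω < κ.ord
  coe_eq : ∀ x : M, (i x).1 = x.1
  succ_subset : insert (cardSet κ) (cardSet κ) ⊆ M
  closed : ClosedUnderSeq (aleph 1) M
  preserving : IsPowersetPreserving κ j

namespace PreservingSetting

variable {κ : Cardinal.{u}} {q : ZFSet.{u} → Prop} {M N : ZFSet.{u}}
  {i : M ↪ₑ[setLang] Subtype q} {j : M ↪ₑ[setLang] N}

theorem toZFSet_mem (h : PreservingSetting κ i j) {o : Ordinal.{u}} (ho : o ≤ κ.ord) :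
    o.toZFSet ∈ M := by
  refine h.succ_subset (ZFSet.mem_insert_iff.2 ?_)
  rcases ho.lt_or_eq with ho | rfl
  · exact .inr (toZFSet_mem_toZFSet_iff.2 ho)
  · exact .inl rfl

theorem cardSet_mem (h : PreservingSetting κ i j) : cardSet κ ∈ M := h.toZFSet_mem le_rfl

theorem fixes (h : PreservingSetting κ i j) {o : Ordinal.{u}} (ho : o < κ.ord) (x : M)
    (hx : x.1 = o.toZFSet) : (j x).1 = o.toZFSet :=
  (h.preserving.fixes x (hx ▸ toZFSet_mem_toZFSet_iff.2 ho)).trans hx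

/-- M may miss elements of x, but the inclusion passes to q, which is transitive. -/
theorem subset_of_mem_subsetsIn (h : PreservingSetting κ i j) {x : ZFSet.{u}}
    (hx : x ∈ subsetsIn M κ) : x ⊆ cardSet κ := by
  have := (subset_map_iff i ⟨x, hx.1⟩ ⟨_, h.cardSet_mem⟩).1 fun y hy => hx.2 y.1 y.2 hy
  rw [h.coe_eq, h.coe_eq] at this
  have hqx : q x := (congrArg q (h.coe_eq ⟨x, hx.1⟩)).mp (i ⟨x, hx.1⟩).2
  exact fun y hy => this ⟨y, h.ambient.of_mem hy hqx⟩ hy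

theorem mem_target (h : PreservingSetting κ i j) {x : ZFSet.{u}} (hx : x ∈ M)
    (hxκ : x ⊆ cardSet κ) : x ∈ N := by
  have : x ∈ subsetsIn M κ := ⟨hx, fun y _ hy => hxκ hy⟩
  rw [h.preserving.same_subsets] at this
  exact this.1

theorem mem_source (h : PreservingSetting κ i j) {x : ZFSet.{u}} (hx : x ∈ N)
    (hxκ : ∀ y ∈ N, y ∈ x → y ∈ cardSet κ) : x ∈ M ∧ x ⊆ cardSet κ := by
  have : x ∈ subsetsIn N κ := ⟨hx, hxκ⟩
  rw [← h.preserving.same_subsets] at this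
  exact ⟨this.1, h.subset_of_mem_subsetsIn this⟩

theorem toZFSet_mem_target (h : PreservingSetting κ i j) {o : Ordinal.{u}} (ho : o ≤ κ.ord) :
    o.toZFSet ∈ N :=
  h.mem_target (h.toZFSet_mem ho) (toZFSet_subset_toZFSet_iff.2 ho)

/-- Ordinals of N are comparable in N. If j(κ) were below κ, it would be a fixed ordinal, against
injectivity of j. -/
theorem cardSet_mem_map (h : PreservingSetting κ i j) {c : M} (hc : c.1 = cardSet κ) :
    cardSet κ ∈ (j c).1 := by
  let cN : N := ⟨cardSet κ, h.toZFSet_mem_target le_rfl⟩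
  have htri := (isOrd_trichotomy_map_iff j).1 ((isOrd_trichotomy_map_iff i).2 fun a b ha hb => by
    rw [Subtype.ext_iff]
    exact ((h.ambient.isOrd_iff a).1 ha).mem_trichotomous ((h.ambient.isOrd_iff b).1 hb))
  have hjc : IsOrd (j c) := by
    rw [← isOrd_map_iff j, isOrd_map_iff i, h.ambient.isOrd_iff, h.coe_eq, hc]
    exact isOrdinal_toZFSet _
  have hcN : IsOrd cN := by
    have := isOrdinal_toZFSet κ.ord
    exact ⟨fun x hx y hy => this.mem_trans hy hx,
      fun x hx y hy z hz => (this.mem hx).mem_trans hz hy⟩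
  rcases htri cN (j c) hcN hjc with h1 | h1 | h1
  · exact h1
  · refine absurd (congrArg Subtype.val h1).symm ?_
    change (j c).1 ≠ cardSet κ
    rw [← hc]
    exact h.preserving.moves c hc
  · obtain ⟨o, ho, hjo⟩ := exists_of_mem_toZFSet (show (j c).1 ∈ κ.ord.toZFSet from h1)
    have h2 := h.fixes ho ⟨_, h.toZFSet_mem ho.le⟩ rfl
    have h3 := j.injective (Subtype.ext (hjo.trans h2.symm))
    have h4 : κ.ord = o := toZFSet_injective (hc.symm.trans (congrArg Subtype.val h3))
    exact absurd h4 ho.ne'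

theorem exists_pairGraph (h : PreservingSetting κ i j) {c : M} (hc : c.1 = cardSet κ) :
    ∃ p, PairGraph p c := by
  rw [exists_pairGraph_map_iff i]
  exact h.ambient.exists_pairGraph h.regular ((h.coe_eq c).trans hc)

theorem adequate_ambient (h : PreservingSetting κ i j) {p c : M} (hc : c.1 = cardSet κ)
    (hp : PairGraph p c) : Adequate κ (i p) :=
  h.ambient.adequate_of_pairGraph h.regular ((h.coe_eq c).trans hc)
    ((pairGraph_map_iff i p c).1 hp)

theorem adequate (h : PreservingSetting κ i j) {p c : M} (hc : c.1 = cardSet κ)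
    (hp : PairGraph p c) : Adequate κ p where
  mem := fun o ho => h.toZFSet_mem ho.le
  app_iff := fun {x o} hxo ho {ξ a} hξ ha z => by
    rw [app_map_iff i, (h.adequate_ambient hc hp).app_iff hxo ho ((h.coe_eq ξ).trans hξ)
      ((h.coe_eq a).trans ha), h.coe_eq]

theorem pairFun_target (h : PreservingSetting κ i j) {p c : M} (hc : c.1 = cardSet κ)
    (hp : PairGraph p c) : PairFun (j p) (j c) :=
  (pairFun_map_iff j p c).1 ((h.adequate hc hp).pairFun h.regular hc)

/-- Arguments and value are fixed by j, and `PairFun` makes the value unique in N. -/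
theorem adequate_target (h : PreservingSetting κ i j) {p c : M} (hc : c.1 = cardSet κ)
    (hp : PairGraph p c) : Adequate κ (j p) where
  mem := fun o ho => h.toZFSet_mem_target ho.le
  app_iff := fun {x o} hxo ho {ξ a} hξ ha z => by
    have hlt := pairCode_lt_ord h.regular hxo ho
    let ξ' : M := ⟨_, h.toZFSet_mem (hxo.trans ho.le)⟩
    let a' : M := ⟨_, h.toZFSet_mem ho.le⟩
    let z' : M := ⟨_, h.toZFSet_mem hlt.le⟩
    have hξ' : j ξ' = ξ := Subtype.ext ((h.fixes (hxo.trans_lt ho) ξ' rfl).trans hξ.symm)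
    have ha' : j a' = a := Subtype.ext ((h.fixes ho a' rfl).trans ha.symm)
    have hz' := h.fixes hlt z' rfl
    have happ := (app_map_iff j p ξ' a' z').1
      (((h.adequate hc hp).app_iff hxo ho rfl rfl z').2 rfl)
    rw [hξ', ha'] at happ
    have hac : a.1 ∈ (j c).1 := by
      rw [← ha', ← mem_map_iff j, hc]
      exact toZFSet_mem_toZFSet_iff.2 ho
    obtain ⟨y, -, -, -, hy⟩ := h.pairFun_target hc hp a hac ξ (mem_or_eq_of_le hξ ha hxo)
    constructor
    · intro hz
      rw [hy z hz, ← hy _ happ, hz']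
    · intro hz
      rwa [show z = j z' from Subtype.ext (hz.trans hz'.symm)]

/-- The colours of the pairs (ξ, κ) under j(F) form a subset of κ in N, which powerset preservation
brings into M. -/
theorem exists_derivative (h : PreservingSetting κ i j) {p : M} {k : N} (hk : k.1 = cardSet κ)
    (F : M) : ∃ D : M, D.1 ⊆ cardSet κ ∧
      ∀ x : N, x.1 ∈ k.1 → (x.1 ∈ D.1 ↔ ∃ z : N, z.1 ∈ (j F).1 ∧ App (j p) x k z) := by
  obtain ⟨D, hD⟩ := (forall_exists_derivedSet_map_iff j).1
    ((forall_exists_derivedSet_map_iff i).2 fun c p F => h.ambient.exists_sep _ c) k (j p) (j F)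
  have hDκ : ∀ y ∈ N, y ∈ D.1 → y ∈ cardSet κ := fun y hy hyD => hk ▸ ((hD ⟨y, hy⟩).1 hyD).1
  obtain ⟨h1, h2⟩ := h.mem_source D.2 hDκ
  exact ⟨⟨D.1, h1⟩, h2, fun x hx => (hD x).trans (and_iff_right hx)⟩

/-- This is where countable closure enters: the sequence of derivatives is defined from j, outside
M. -/
theorem exists_seq (h : PreservingSetting κ i j) (F : ℕ → M) : ∃ s : M, ∀ k y : M,
    Rel s k y ↔ ∃ n : ℕ, k.1 = toZFSet n ∧ y = F n := by
  let s : ZFSet.{u} := ZFSet.sep (fun z => ∃ n : ℕ, z = ZFSet.pair (toZFSet n) (F n).1)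
    (ZFSet.prod (toZFSet ω) M)
  have hs : ∀ x y, ZFSet.pair x y ∈ s ↔ ∃ n : ℕ, x = toZFSet n ∧ y = (F n).1 := by
    intro x y
    rw [ZFSet.mem_sep, ZFSet.pair_mem_prod]
    constructor
    · rintro ⟨-, n, hn⟩
      exact ⟨n, ZFSet.pair_inj.1 hn⟩
    · rintro ⟨n, rfl, rfl⟩
      exact ⟨⟨toZFSet_mem_toZFSet_iff.2 (natCast_lt_omega0 n), (F n).2⟩, n, rfl⟩
  have hsM : s ∈ M := by
    refine h.closed ω ?_ s ⟨ZFSet.sep_subset, fun z hz => ?_⟩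
    · rw [omega0_lt_ord]
      exact aleph0_lt_aleph_one
    · obtain ⟨m, hm, rfl⟩ := exists_of_mem_toZFSet hz
      obtain ⟨n, rfl⟩ := lt_omega0.1 hm
      refine ⟨(F n).1, (hs _ _).2 ⟨n, rfl, rfl⟩, fun y hy => ?_⟩
      obtain ⟨n', hn, rfl⟩ := (hs _ _).1 hy
      rw [Nat.cast_injective (toZFSet_injective hn)]
  refine ⟨⟨s, hsM⟩, fun k y => ?_⟩
  have : Rel ⟨s, hsM⟩ k y ↔ Rel (i ⟨s, hsM⟩) (i k) (i y) :=
    (FO.rel (α := Fin 3) 0 1 2).map i ![⟨s, hsM⟩, k, y]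
  rw [this, h.ambient.rel_iff, h.coe_eq, h.coe_eq, h.coe_eq, hs]
  simp only [Subtype.ext_iff]

theorem exists_join (h : PreservingSetting κ i j) {p c : M} (hc : c.1 = cardSet κ)
    (hp : PairGraph p c) (F : ℕ → M) (hF : ∀ n, (F n).1 ⊆ cardSet κ) :
    ∃ S : M, S.1 ⊆ cardSet κ ∧
      ∀ (n : ℕ) (k : M), k.1 = toZFSet n → SectionIn S (F n) k c p := by
  obtain ⟨s, hs⟩ := h.exists_seq F
  let w : M := ⟨toZFSet ω, h.toZFSet_mem h.omega_lt.le⟩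
  obtain ⟨S, hS⟩ := (exists_joinIn_map_iff i s p c w).2 (h.ambient.exists_sep _ (i c))
  have hA := h.adequate hc hp
  refine ⟨S, h.subset_of_mem_subsetsIn ⟨S.2, fun y hy hyS => hc ▸ ((hS ⟨y, hy⟩).1 hyS).1⟩, ?_⟩
  intro n k hk ξ hξ hkξ z hz
  rw [hc] at hξ
  obtain ⟨x, hx, hξx⟩ := exists_of_mem_toZFSet hξ
  have hnx : (n : Ordinal.{u}) < x := by
    rwa [hk, hξx, toZFSet_mem_toZFSet_iff] at hkξ
  have hz' := (hA.app_iff hnx.le hx hk hξx z).1 hz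
  rw [hS z]
  constructor
  · rintro ⟨-, k', -, y, hky, ξ', hξ', hkξ', happ⟩
    obtain ⟨m, hm, rfl⟩ := (hs k' y).1 hky
    obtain ⟨x', hx', hξx'⟩ := exists_of_mem_toZFSet (hF m hξ')
    have hmx : (m : Ordinal.{u}) < x' := by
      rwa [hm, hξx', toZFSet_mem_toZFSet_iff] at hkξ'
    rw [hA.app_iff hmx.le hx' hm hξx' z, hz'] at happ
    obtain ⟨h1, h2⟩ := pairCode_inj hnx.le hmx.le (toZFSet_injective happ)
    rw [Nat.cast_injective h1, show ξ = ξ' from Subtype.ext (by rw [hξx, hξx', h2])]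
    exact hξ'
  · intro hξF
    refine ⟨?_, k, ?_, F n, (hs k _).2 ⟨n, hk, rfl⟩, ξ, hξF, hkξ, hz⟩
    · rw [hz', hc]
      exact toZFSet_mem_toZFSet_iff.2 (pairCode_lt_ord h.regular hnx.le hx)
    · rw [hk]
      exact toZFSet_mem_toZFSet_iff.2 (natCast_lt_omega0 n)

/-- For ξ < κ: code(n, code(ξ, κ)) ∈ j(S) iff code(ξ, κ) ∈ j(F_n) iff ξ ∈ F_{n+1} iff ξ ∈ j(F_{n+1})
iff code(n+1, ξ) ∈ j(S). The outer steps are elementarity, the second is the definition of the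
derivative, the third holds as j fixes ξ. -/
theorem goodIn_target (h : PreservingSetting κ i j) {p c w : M} (hc : c.1 = cardSet κ)
    (hw : w.1 = toZFSet ω) (hp : PairGraph p c) {k : N} (hk : k.1 = cardSet κ) {F : ℕ → M}
    (hF : ∀ n, ∀ x : N, x.1 ∈ k.1 →
      (x.1 ∈ (F (n + 1)).1 ↔ ∃ z : N, z.1 ∈ (j (F n)).1 ∧ App (j p) x k z))
    {S : M} (hS : ∀ (n : ℕ) (m : M), m.1 = toZFSet n → SectionIn S (F n) m c p) :
    GoodIn k (j S) (j p) (j w) := by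
  have hA := h.adequate_target hc hp
  have hkc : k.1 ∈ (j c).1 := hk ▸ h.cardSet_mem_map hc
  have hjw : (j w).1 = toZFSet ω := h.fixes h.omega_lt w hw
  have hsub : ∀ x : N, x.1 ∈ k.1 → x.1 ∈ (j c).1 := fun x hx => by
    rw [hk] at hx
    obtain ⟨o, ho, hxo⟩ := exists_of_mem_toZFSet hx
    have := (mem_map_iff j ⟨_, h.toZFSet_mem ho.le⟩ c).1
      (by rw [hc]; exact toZFSet_mem_toZFSet_iff.2 ho)
    rwa [h.fixes ho ⟨_, h.toZFSet_mem ho.le⟩ rfl, ← hxo] at this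
  refine ⟨?_, ?_, ?_⟩
  · rw [hjw, hk]
    exact toZFSet_mem_toZFSet_iff.2 h.omega_lt
  · intro b hb ξ hξ z hz
    rw [hk] at hb ⊢
    obtain ⟨o, ho, hbo⟩ := exists_of_mem_toZFSet hb
    obtain ⟨x, hxo, hξx⟩ := exists_of_mem_or_eq hbo hξ
    rw [(hA.app_iff hxo ho hξx hbo z).1 hz]
    exact toZFSet_mem_toZFSet_iff.2 (pairCode_lt_ord h.regular hxo ho)
  · intro m hm m' hm' ξ hξ hmξ z hz y hy y' hy'
    rw [hjw] at hm
    obtain ⟨n', hn, hmn⟩ := exists_of_mem_toZFSet hm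
    obtain ⟨n, rfl⟩ := lt_omega0.1 hn
    have hfix : ∀ n : ℕ, (j ⟨toZFSet n, h.toZFSet_mem
        ((natCast_lt_omega0 n).trans h.omega_lt).le⟩).1 = toZFSet n := fun n =>
      h.fixes ((natCast_lt_omega0 n).trans h.omega_lt) _ rfl
    have hm'n : m'.1 = toZFSet (n + 1 : ℕ) := by
      rw [hk] at hξ
      obtain ⟨x, hx, hξx⟩ := exists_of_mem_toZFSet hξ
      rw [hξx] at hmξ
      obtain ⟨o, ho, hmo⟩ := exists_of_mem_toZFSet hmξ
      rw [Nat.cast_add, Nat.cast_one, toZFSet_add_one]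
      ext t
      rw [ZFSet.mem_insert_iff, ← hmn]
      constructor
      · intro ht
        rw [hmo] at ht
        obtain ⟨r, hr, rfl⟩ := exists_of_mem_toZFSet ht
        have := (hm' ⟨_, h.toZFSet_mem_target (hr.trans (ho.trans hx)).le⟩).1
          (by rw [hmo]; exact ht)
        exact this.symm.imp_left (congrArg Subtype.val)
      · rintro (rfl | ht)
        · exact (hm' m).2 (.inr rfl)
        · have ht' := ht
          rw [hmn] at ht'
          obtain ⟨r, hr, rfl⟩ := exists_of_mem_toZFSet ht'
          exact (hm' ⟨_, h.toZFSet_mem_target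
            (hr.trans ((natCast_lt_omega0 n).trans h.omega_lt)).le⟩).2 (.inl ht)
    have hsec : ∀ (n : ℕ) (m : N), m.1 = toZFSet n → SectionIn (j S) (j (F n)) m (j c) (j p) := by
      intro n m hm
      have := (sectionIn_map_iff j _ _ _ _ _).1 (hS n ⟨toZFSet n, h.toZFSet_mem
        ((natCast_lt_omega0 n).trans h.omega_lt).le⟩ rfl)
      rwa [show j _ = m from Subtype.ext ((hfix n).trans hm.symm)] at this
    have hmk : m.1 ∈ k.1 := by
      rw [hmn, hk]
      exact toZFSet_mem_toZFSet_iff.2 ((natCast_lt_omega0 n).trans h.omega_lt)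
    -- The code of (ξ, κ) in N need not be a true ordinal; it is controlled only through `PairFun`.
    obtain ⟨z', hz'c, hkz, -, huniq⟩ := h.pairFun_target hc hp k hkc ξ (.inl hξ)
    obtain rfl := huniq z hz
    rw [hsec n m hmn z hz'c (hkz m hmk) y hy, hsec (n + 1) m' hm'n ξ (hsub ξ hξ) hmξ y' hy']
    have hξfix : ξ.1 ∈ (j (F (n + 1))).1 ↔ ξ.1 ∈ (F (n + 1)).1 := by
      rw [hk] at hξ
      obtain ⟨x, hx, hξx⟩ := exists_of_mem_toZFSet hξ
      have := mem_map_iff j ⟨_, h.toZFSet_mem hx.le⟩ (F (n + 1))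
      rw [h.fixes hx ⟨_, h.toZFSet_mem hx.le⟩ rfl] at this
      rw [hξx, this]
    rw [hξfix, hF n ξ hξ]
    constructor
    · exact fun hzF => ⟨z, hzF, hz⟩
    · rintro ⟨t, ht, hta⟩
      rwa [← huniq t hta]

/-- Every colouring in `M` has, in `M`, an unbounded set of end-homogeneous points. -/
theorem exists_homogeneous (h : PreservingSetting κ i j) (F : M) (hF : F.1 ⊆ cardSet κ) :
    ∃ S X : M, S.1 ⊆ cardSet κ ∧ X.1 ⊆ cardSet κ ∧
      (∀ β < κ.ord, ∃ a < κ.ord, β < a ∧ a.toZFSet ∈ X.1) ∧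
      (∀ a < κ.ord, a.toZFSet ∈ X.1 → EndHomogeneousAt {x | x.toZFSet ∈ S.1} a) ∧
      ∀ ξ < κ.ord, 0 < ξ → ((pairCode 0 ξ).toZFSet ∈ S.1 ↔ ξ.toZFSet ∈ F.1) := by
  let c : M := ⟨cardSet κ, h.cardSet_mem⟩
  let w : M := ⟨toZFSet ω, h.toZFSet_mem h.omega_lt.le⟩
  let k : N := ⟨cardSet κ, h.toZFSet_mem_target le_rfl⟩
  obtain ⟨p, hp⟩ := h.exists_pairGraph (c := c) rfl
  have hA := h.adequate rfl hp
  choose d hd hd' using h.exists_derivative (p := p) (k := k) rfl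
  let G : ℕ → M := fun n => Nat.rec F (fun _ D => d D) n
  have hG : ∀ n, (G n).1 ⊆ cardSet κ := fun n => by
    cases n with
    | zero => exact hF
    | succ n => exact hd _
  obtain ⟨S, hSκ, hS⟩ := h.exists_join rfl hp G hG
  obtain ⟨X, hX⟩ := (exists_goodSet_map_iff i c S p w).2 (h.ambient.exists_sep _ (i c))
  have hXκ : X.1 ⊆ cardSet κ :=
    h.subset_of_mem_subsetsIn ⟨X.2, fun y hy hyX => ((hX ⟨y, hy⟩).1 hyX).1⟩
  have hkX : k.1 ∈ (j X).1 := ((goodSet_map_iff j X c S p w).1 hX k).2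
    ⟨h.cardSet_mem_map rfl, h.goodIn_target rfl rfl hp rfl (fun n x hx => hd' (G n) x hx) hS⟩
  refine ⟨S, X, hSκ, hXκ, fun β hβ => ?_, fun a ha haX => ?_, fun ξ hξ h0 => ?_⟩
  · let b : M := ⟨_, h.toZFSet_mem hβ.le⟩
    -- In N, κ is an element of j(X) above β = j(β).
    obtain ⟨a, haX, hba⟩ := (exists_mem_gt_map_iff j X b).2 ⟨k, hkX, by
      rw [h.fixes hβ b rfl]
      exact toZFSet_mem_toZFSet_iff.2 hβ⟩
    obtain ⟨o, ho, hao⟩ := exists_of_mem_toZFSet (hXκ haX)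
    rw [hao] at hba haX
    exact ⟨o, ho, toZFSet_mem_toZFSet_iff.1 hba, haX⟩
  · exact (hA.goodIn_iff h.regular ha rfl rfl).1 ((hX ⟨_, h.toZFSet_mem ha.le⟩).1 haX).2
  · have h00 := h0.trans hξ
    exact hS 0 ⟨_, h.toZFSet_mem h00.le⟩ (by rw [Nat.cast_zero]) ⟨_, h.toZFSet_mem hξ.le⟩
      (toZFSet_mem_toZFSet_iff.2 hξ) (toZFSet_mem_toZFSet_iff.2 h0)
      ⟨_, h.toZFSet_mem (pairCode_lt_ord h.regular h0.le hξ).le⟩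
      ((hA.app_iff h0.le hξ rfl rfl _).2 rfl)

/-- Colourings of κ pass from N to M and the witnesses pass back, all being subsets of κ. -/
theorem homIn_target (h : PreservingSetting κ i j) {p c : M} (hc : c.1 = cardSet κ)
    (hp : PairGraph p c) {k w : N} (hk : k.1 = cardSet κ) (hw : w.1 = toZFSet ω) :
    HomIn k (j p) w := by
  have hA := h.adequate_target hc hp
  intro F hF
  rw [hk] at hF ⊢
  obtain ⟨hFM, hFκ⟩ := h.mem_source F.2 fun y hy hyF => hF ⟨y, hy⟩ hyF
  obtain ⟨S, X, hSκ, hXκ, h1, h2, h3⟩ := h.exists_homogeneous ⟨F.1, hFM⟩ hFκ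
  refine ⟨⟨S.1, h.mem_target S.2 hSκ⟩, ⟨X.1, h.mem_target X.2 hXκ⟩, fun x hx => hXκ hx, ?_, ?_, ?_⟩
  · intro β hβ
    obtain ⟨b, hb, hβb⟩ := exists_of_mem_toZFSet hβ
    obtain ⟨a, ha, hba, haX⟩ := h1 b hb
    refine ⟨⟨_, h.toZFSet_mem_target ha.le⟩, haX, ?_⟩
    rw [hβb]
    exact toZFSet_mem_toZFSet_iff.2 hba
  · intro a ha
    obtain ⟨o, ho, hao⟩ := exists_of_mem_toZFSet (hXκ ha)
    rw [hA.goodIn_iff h.regular ho hao hw]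
    exact h2 o ho (hao ▸ ha)
  · intro e he ξ hξ heξ z hz
    obtain ⟨x, hx, hξx⟩ := exists_of_mem_toZFSet hξ
    rw [hξx] at heξ
    obtain ⟨o, ho, heo⟩ := exists_of_mem_toZFSet heξ
    -- The set e is empty only in the sense of N, but a nonzero ordinal would contain 0, which lies
    -- in N.
    obtain rfl : o = 0 := by
      by_contra h0
      refine he ⟨_, h.toZFSet_mem_target (zero_le (a := κ.ord))⟩ ?_
      rw [heo]
      exact toZFSet_mem_toZFSet_iff.2 (pos_iff_ne_zero.2 h0)
    rw [(hA.app_iff ho.le hx heo hξx z).1 hz, hξx]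
    exact h3 x hx ho

/-- In N, κ itself is a witness between j(μ) = μ and j(κ). Elementarity gives a witness below κ in
M, then in q, where the notion is correct. -/
theorem exists_endHomogeneous_lt (h : PreservingSetting κ i j) {μ : Ordinal.{u}}
    (hμ : μ < κ.ord) : ∃ ν, μ < ν ∧ ν < κ.ord ∧ EndHomogeneous ν := by
  let c : M := ⟨cardSet κ, h.cardSet_mem⟩
  let w : M := ⟨toZFSet ω, h.toZFSet_mem h.omega_lt.le⟩
  let m : M := ⟨_, h.toZFSet_mem hμ.le⟩
  let k : N := ⟨cardSet κ, h.toZFSet_mem_target le_rfl⟩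
  obtain ⟨p, hp⟩ := h.exists_pairGraph (c := c) rfl
  have hN : ∃ ν : N, ν.1 ∈ (j c).1 ∧ (j m).1 ∈ ν.1 ∧ HomIn ν (j p) (j w) := by
    refine ⟨k, h.cardSet_mem_map rfl, ?_, h.homIn_target rfl hp rfl (h.fixes h.omega_lt w rfl)⟩
    rw [h.fixes hμ m rfl]
    exact toZFSet_mem_toZFSet_iff.2 hμ
  obtain ⟨ν, h1, h2, h3⟩ :=
    (exists_homIn_map_iff i c m p w).1 ((exists_homIn_map_iff j c m p w).2 hN)
  rw [h.coe_eq] at h1 h2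
  obtain ⟨o, ho, hνo⟩ := exists_of_mem_toZFSet h1
  rw [hνo] at h2
  exact ⟨o, toZFSet_mem_toZFSet_iff.1 h2, ho,
    (h.adequate_ambient rfl hp).endHomogeneous_of_homIn h.regular h.ambient ho hνo
      (h.coe_eq w) h3⟩

end PreservingSetting

/-! ### From the embeddings to the partition property of κ -/

theorem IsAlphaRamsey.exists_setting {κ : Cardinal.{u}} (hκ : IsAlphaRamsey (aleph 1) κ)
    {A : ZFSet.{u}} (hA : A ⊆ cardSet κ) : ∃ (q : ZFSet.{u} → Prop) (M N : ZFSet.{u})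
      (i : M ↪ₑ[setLang] Subtype q) (j : M ↪ₑ[setLang] N), A ∈ M ∧ PreservingSetting κ i j := by
  -- With θ above the size of V_κ, all subsets of V_κ are in H(θ).
  obtain ⟨θ, hθ, -, H1⟩ := hκ.exists_embedding (vonNeumann κ.ord).card
  obtain ⟨M, hAM, hM, ⟨i, hi⟩, hcl, N, j, hj⟩ := H1 A hA
  exact ⟨_, M, N, i, j, hAM, ambient_H hθ, hκ.regular,
    omega0_lt_ord.2 (aleph0_lt_aleph_one.trans_le hκ.le), hi, hM.succ_subset, hcl, hj⟩

theorem IsAlphaRamsey.endHomogeneous {κ : Cardinal.{u}} (hκ : IsAlphaRamsey (aleph 1) κ) :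
    EndHomogeneous κ.ord := by
  intro F hF
  let A : ZFSet.{u} := ZFSet.sep (fun z => ∃ x ∈ F, z = x.toZFSet) (cardSet κ)
  have hA : ∀ x < κ.ord, (x.toZFSet ∈ A ↔ x ∈ F) := fun x hx => by
    rw [ZFSet.mem_sep]
    constructor
    · rintro ⟨-, y, hy, hxy⟩
      rwa [toZFSet_injective hxy]
    · exact fun hxF => ⟨toZFSet_mem_toZFSet_iff.2 hx, x, hxF, rfl⟩
  obtain ⟨q, M, N, i, j, hAM, h⟩ := hκ.exists_setting (A := A) ZFSet.sep_subset
  obtain ⟨S, X, -, hXκ, h1, h2, h3⟩ := h.exists_homogeneous ⟨A, hAM⟩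
    (show A ⊆ cardSet κ from ZFSet.sep_subset)
  refine ⟨{x | x.toZFSet ∈ S.1}, {x | x.toZFSet ∈ X.1}, fun x hx => ?_, fun β hβ => ?_, ?_, ?_⟩
  · exact toZFSet_mem_toZFSet_iff.1 (hXκ hx)
  · obtain ⟨a, -, hβa, haX⟩ := h1 β hβ
    exact ⟨a, haX, hβa⟩
  · exact fun a ha => h2 a (toZFSet_mem_toZFSet_iff.1 (hXκ ha)) ha
  · exact fun ξ hξ h0 => (h3 ξ hξ h0).trans (hA ξ hξ)

end LargeCardinal

theorem proposition5p4 (κ : Cardinal.{u})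
    (hκ : LargeCardinal.IsAlphaRamsey (Cardinal.aleph 1) κ) :
    LargeCardinal.IsRamsey κ ∧
      ∀ μ : Cardinal.{u}, μ < κ →
        ∃ ν : Cardinal.{u}, μ < ν ∧ ν < κ ∧ LargeCardinal.IsRamsey ν := by
  refine ⟨hκ.endHomogeneous.isRamsey hκ.regular.pos, fun μ hμ => ?_⟩
  obtain ⟨q, M, N, i, j, -, h⟩ := hκ.exists_setting (A := ∅) (ZFSet.empty_subset _)
  obtain ⟨ν, hμν, hνκ, hν⟩ := h.exists_endHomogeneous_lt (Cardinal.ord_lt_ord.2 hμ)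
  -- Reflection yields only an ordinal ν; being its own cofinality, it is the cardinal `ν.cof`.
  have hc := hν.ord_cof
  rw [← hc] at hμν hνκ hν
  exact ⟨ν.cof, Cardinal.ord_lt_ord.1 hμν, Cardinal.ord_lt_ord.1 hνκ,
    hν.isRamsey (pos_of_gt (Cardinal.ord_lt_ord.1 hμν))⟩
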